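/- Let $\mathcal S,\mathcal A,\mathcal B$ be finite nonempty sets of sizes $S,A,B$, and consider two-player zero-sum simultaneous stochastic games $(\mathcal S,\mathcal A,\mathcal B,r,P)$ with $r(s,a,b)\in[0,1]$ and transition probabilities $P(\cdot\mid s,a,b)$. For Markovian policies $\mu:\mathcal S\to\Delta_{\mathcal A}$ (max-player, the learner) and $\nu:\mathcal S\to\Delta_{\mathcal B}$ (min-player, the opponent), let $J^{(\mu,\nu)}(s)$ be the long-run expected average reward from $s$, and $T^{(\mu,\nu)}_{s\to s'}$ the expected time to reach $s'$ from $s$. Let $D>0$ be a real number, known to the learner, and suppose that the diameter of the game is at most $D$: $$\sup_{s,s'}\ \sup_{\nu}\ \inf_{\mu}\ T^{(\mu,\nu)}_{s\to s'}\le D$$ (in particular, against every Markovian policy of the opponent the learner can go from any state to any other). Then the average-reward game has a value $J^*$ independent of the initial state, i.e. $J^*=\sup_\mu\inf_\nu J^{(\mu,\nu)}(s)=\inf_\nu\sup_\mu J^{(\mu,\nu)}(s)$ for all $s$. The regret after $T$ steps is $\mathrm{Reg}(T)=\sum_{t=1}^T\bigl(J^*-r(s_t,a_t,b_t)\bigr)$.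 DONQ-learning with horizon $T$ and parameters $H>1$, $\delta\in(0,1)$ is the following algorithm. Put $\gamma=1-1/H$, $\alpha_\tau=\frac{H+1}{H+\tau}$, $\beta_\tau=2D\sqrt{H\log(2T/\delta)/\tau}$, and initialize $\overline Q_1=\overline Q_1^{\downarrow}=\overline V_1^{\downarrow}=H$, $N_1=0$, $\mu_1(\cdot\mid s)$ uniform. At each step $t=1,\dots,T$, draw $a_t\sim\mu_t(\cdot\mid s_t)$, while the opponent simultaneously draws $b_t$ from an arbitrary distribution depending on the history up to and including $s_t$; observe $b_t$, $r(s_t,a_t,b_t)$ and $s_{t+1}\sim P(\cdot\mid s_t,a_t,b_t)$. Let $\tau=N_{t+1}(s_t,a_t,b_t)=N_t(s_t,a_t,b_t)+1$ and $$\overline Q_{t+1}(s_t,a_t,b_t)=(1-\alpha_\tau)\overline Q_t(s_t,a_t,b_t)+\alpha_\tau\bigl[r(s_t,a_t,b_t)+\gamma\overline V^{\downarrow}_t(s_{t+1})+\beta_\tau\bigr],$$ $$\overline Q^{\downarrow}_{t+1}(s_t,a_t,b_t)=\min\bigl(\overline Q^{\downarrow}_t(s_t,a_t,b_t),\overline Q_{t+1}(s_t,a_t,b_t)\bigr);$$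 let $(\mu_{t+1}(\cdot\mid s_t),\tilde\nu_{t+1}(\cdot\mid s_t))$ be a Nash equilibrium of the matrix game $\overline Q^{\downarrow}_{t+1}(s_t,\cdot,\cdot)$, returned by a fixed procedure, and $\overline V^{\downarrow}_{t+1}(s_t)$ the payoff of this equilibrium. All other entries are unchanged. For every $D>0$ and $\delta\in(0,1)$ there are a function $\varepsilon(T)=o(T^{3/4})$ and $T_0$, depending only on $S,A,B,D,\delta$, such that for all $T\ge T_0$ the parameter $$H=\sqrt{\frac{D}{\log(2/\delta)^{1/2}}}\;T^{1/4}$$ satisfies $H>1$ and, for every game on $\mathcal S,\mathcal A,\mathcal B$ of diameter at most $D$, every procedure returning Nash equilibria of matrix games, every opponent and every initial state, DONQ-learning with horizon $T$ and parameters $H,\delta$ satisfies, with probability at least $1-3\delta$, $$\mathrm{Reg}(T)\le\sqrt{D\log(2/\delta)^{1/2}}\;T^{3/4}+\varepsilon(T).$$ -/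

import Mathlib

open Filter Asymptotics
open scoped ENNReal

noncomputable section

/-- A two-player zero-sum simultaneous stochastic game with rewards in `[0, 1]`. -/
structure StochasticGame (S A B : Type*) where
  /-- reward won by the max-player (and lost by the min-player) -/
  r : S → A → B → ℝ
  r_nonneg : ∀ s a b, 0 ≤ r s a b
  r_le_one : ∀ s a b, r s a b ≤ 1
  /-- transition probabilities `P(· | s, a, b)` -/
  P : S → A → B → PMF S

/-- Expected payoff of the matrix game `M` under independent mixed actions `μ` and `ν`. -/
def matrixPayoff {A B : Type*} [Fintype A] [Fintype B] (μ : PMF A) (ν : PMF B)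
    (M : A → B → ℝ) : ℝ :=
  ∑ a, ∑ b, (μ a).toReal * (ν b).toReal * M a b

/-- `(μ, ν)` is a Nash equilibrium of the zero-sum matrix game `M`
(rows maximize, columns minimize). -/
def IsMatrixNash {A B : Type*} [Fintype A] [Fintype B] (M : A → B → ℝ)
    (μ : PMF A) (ν : PMF B) : Prop :=
  (∀ μ' : PMF A, matrixPayoff μ' ν M ≤ matrixPayoff μ ν M) ∧
    (∀ ν' : PMF B, matrixPayoff μ ν M ≤ matrixPayoff μ ν' M)

namespace StochasticGame

variable {S A B : Type*} (G : StochasticGame S A B)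

/-- The transition kernel `P^{(μ,ν)}(· | s)` of a pair of Markovian policies. -/
def policyKernel (μ : S → PMF A) (ν : S → PMF B) (s : S) : PMF S :=
  (μ s).bind fun a => (ν s).bind fun b => G.P s a b

/-- Law of the state after `n` steps of the Markov chain `P^{(μ,ν)}` started at `s`. -/
def stateLaw (μ : S → PMF A) (ν : S → PMF B) (s : S) : ℕ → PMF S
  | 0 => PMF.pure s
  | n + 1 => (stateLaw μ ν s n).bind (G.policyKernel μ ν)

/-- Average reward `J^{(μ,ν)}(s)`. For a finite Markov chain the Cesàro averages of the expected
rewards converge, so that this lower limit is their limit. -/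
def averageReward [Fintype S] [Fintype A] [Fintype B] (μ : S → PMF A) (ν : S → PMF B)
    (s : S) : ℝ :=
  liminf (fun T : ℕ =>
    (∑ t ∈ Finset.range T,
      ∑ x, (G.stateLaw μ ν s t x).toReal * matrixPayoff (μ x) (ν x) (G.r x)) / (T : ℝ)) atTop

/-- `J` is the value of the average-reward game, whatever the initial state:
`max_μ min_ν J^{(μ,ν)}(s) = J = min_ν max_μ J^{(μ,ν)}(s)` for all `s`, over Markovian policies. -/
def IsAverageValue [Fintype S] [Fintype A] [Fintype B] (J : ℝ) : Prop :=
  ∀ s, (⨆ μ : S → PMF A, ⨅ ν : S → PMF B, G.averageReward μ ν s) = J ∧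
    (⨅ ν : S → PMF B, ⨆ μ : S → PMF A, G.averageReward μ ν s) = J

/-- Probability that the chain `P^{(μ,ν)}` started at `s` visits `s'` at none of the times
`0, …, n`. -/
def avoidProb [DecidableEq S] (μ : S → PMF A) (ν : S → PMF B) (s' : S) : ℕ → S → ℝ≥0∞
  | 0, s => if s = s' then 0 else 1
  | n + 1, s =>
      if s = s' then 0 else ∑' x, G.policyKernel μ ν s x * avoidProb μ ν s' n x

/-- Expected time `E[τ] = ∑ₙ P(τ > n)` to go from `s` to `s'` under `(μ, ν)`
(`0` if `s = s'`; possibly infinite). -/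
def expectedHittingTime [DecidableEq S] (μ : S → PMF A) (ν : S → PMF B) (s s' : S) : ℝ≥0∞ :=
  ∑' n, G.avoidProb μ ν s' n s

/-- The diameter of the game from the point of view of the max-player. It is finite only if, for
every Markovian policy of the min-player, the max-player can go from any state to any other. -/
def diameter [DecidableEq S] : ℝ≥0∞ :=
  ⨆ (s : S) (s' : S) (ν : S → PMF B), ⨅ μ : S → PMF A, G.expectedHittingTime μ ν s s'

end StochasticGame

/-- The quantities that DONQ-learning maintains: visit counts, the optimistic estimators
`Q̄`, `Q̄↓`, `V̄↓`, and the current policy. -/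
structure DONQState (S A B : Type*) where
  N : S → A → B → ℕ
  Q : S → A → B → ℝ
  Qd : S → A → B → ℝ
  V : S → ℝ
  μ : S → PMF A

namespace DONQ

variable {S A B : Type*}

/-- Initialization with parameter `H`. -/
def init (S A B : Type*) [Fintype A] [Nonempty A] (H : ℝ) : DONQState S A B where
  N := fun _ _ _ => 0
  Q := fun _ _ _ => H
  Qd := fun _ _ _ => H
  V := fun _ => H
  μ := fun _ => PMF.uniformOfFintype A

/-- Learning rate `α_τ`. -/
def rate (H : ℝ) (τ : ℕ) : ℝ := (H + 1) / (H + τ)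

/-- Bonus `β_τ`. -/
def bonus (D H δ : ℝ) (T τ : ℕ) : ℝ := 2 * D * Real.sqrt (H * Real.log (2 * T / δ) / τ)

variable [Fintype S] [Fintype A] [Fintype B] [DecidableEq S] [DecidableEq A] [DecidableEq B]

/-- One update of DONQ-learning, after `a`, `b` have been played in `s` and `s'` has been observed.
Everything not attached to `s` (resp. `(s, a, b)`) is kept. `nash` is the procedure that returns a
pair of Nash policies of a matrix game. -/
def update (G : StochasticGame S A B) (nash : (A → B → ℝ) → PMF A × PMF B) (D H δ : ℝ) (T : ℕ)
    (e : DONQState S A B) (s : S) (a : A) (b : B) (s' : S) : DONQState S A B :=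
  let γ : ℝ := 1 - 1 / H
  let τ : ℕ := e.N s a b + 1
  let q : ℝ := (1 - rate H τ) * e.Q s a b
    + rate H τ * (G.r s a b + γ * e.V s' + bonus D H δ T τ)
  let Qd' : A → B → ℝ :=
    Function.update (e.Qd s) a (Function.update (e.Qd s a) b (min (e.Qd s a b) q))
  { N := Function.update e.N s (Function.update (e.N s) a (Function.update (e.N s a) b τ))
    Q := Function.update e.Q s (Function.update (e.Q s) a (Function.update (e.Q s a) b q))
    Qd := Function.update e.Qd s Qd'
    V := Function.update e.V s (matrixPayoff (nash Qd').1 (nash Qd').2 Qd')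
    μ := Function.update e.μ s (nash Qd').1 }

/-- The state of the algorithm after the history made of the plays `l` (most recent first) and the
current state of the game. -/
def estimate [Nonempty A] (G : StochasticGame S A B) (nash : (A → B → ℝ) → PMF A × PMF B)
    (D H δ : ℝ) (T : ℕ) : List (S × A × B) → S → DONQState S A B
  | [], _ => init S A B H
  | (s, a, b) :: l, s' => update G nash D H δ T (estimate G nash D H δ T l s) s a b s'

/-- Law of the history after `n` steps when the learner runs DONQ-learning from the state `s₁`,
against an opponent whose (randomized) action may depend on the whole past and on the current state:
given the past, the two actions are drawn independently. -/
def historyLaw [Nonempty A] (G : StochasticGame S A B) (nash : (A → B → ℝ) → PMF A × PMF B)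
    (D H δ : ℝ) (T : ℕ) (opp : List (S × A × B) → S → PMF B) (s₁ : S) :
    ℕ → PMF (List (S × A × B) × S)
  | 0 => PMF.pure ([], s₁)
  | n + 1 =>
      (historyLaw G nash D H δ T opp s₁ n).bind fun h =>
        ((estimate G nash D H δ T h.1 h.2).μ h.2).bind fun a =>
          (opp h.1 h.2).bind fun b =>
            (G.P h.2 a b).map fun s' => ((h.2, a, b) :: h.1, s')

end DONQ

/-- Regret `∑ₜ (J - r(sₜ, aₜ, bₜ))` of a list of plays with respect to the value `J`. -/
def regret {S A B : Type*} (G : StochasticGame S A B) (J : ℝ) (l : List (S × A × B)) : ℝ :=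
  (l.map fun p => J - G.r p.1 p.2.1 p.2.2).sum

/-- The parameter `H = √(D / log(2/δ)^{1/2}) · T^{1/4}`. -/
def highProbH (D δ : ℝ) (T : ℕ) : ℝ :=
  Real.sqrt (D / Real.log (2 / δ) ^ (1 / 2 : ℝ)) * (T : ℝ) ^ (1 / 4 : ℝ)

end

/-! The average-reward game is compared with the discounted game of factor `γ = 1 - 1/H`, whose
value `W` and optimal action values `optQ` come from Shapley's contraction. Before hitting a target
state the max-player loses at most one unit of value per step, so the diameter bounds the span of
`W` by `D` (`IsDiscountedValue.le_add_of_diameter_le`). Since optimal discounted policies guarantee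
long-run averages between `(1-γ) min W` and `(1-γ) max W`, letting `γ → 1` yields the value `J`, and
`J ≤ (1-γ)(W + D)` for every `γ` (`exists_isAverageValue`). Discounting thus costs at most `D/H` per
step; for the chosen `H`, the total `TD/H` is exactly the leading term. Everything else must be
`o(T^{3/4})`.

Along a path, `regret_le` bounds the rest. If the bonuses dominate the transition noise, the
estimators are optimistic (`optimism`). A potential with weights `(H + n)/H` turns the learning
recursion into a telescoping sum (`sum_upperQ_sub`): the gap of `Q̄` at the plays is at most `(1 +
1/H)(1 - 1/H) ≤ 1` times the gap of `V̄↓` at the next states, plus noise and bonuses. Monotonicity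
of `V̄↓` replaces next states by current ones, and the gap cancels from both sides.

The delicate term is the fluctuation of `Q̄↓` caused by random actions. Its range is `H`, so a plain
Azuma bound `H √T` would be of order `T^{3/4}`. Instead, `mean_exp_matrixPayoff_sub_le` is an
exponential inequality whose compensator is a difference of squares, `Q̄↓(a, b)²` minus the squared
mean payoff. The Nash property bounds the mean below by `V̄↓`, and the squares telescope like the
values (`sum_lowerQ_sq_sub_le`), so the compensators sum to `O(HT) = O(T^{5/4})` rather than `H² T`.
With parameter `T^{-5/8}` the fluctuation is `O(T^{5/8})`. The largest remaining term is the sum of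
the bonuses, `O(T^{11/16})`. -/

set_option linter.unusedSectionVars false

/-! ### Expectations under finite probabilities -/

section PMFMean

variable {α β : Type*} [Fintype α] [Fintype β]

/-- Expectation of a real function under a probability on a finite type. -/
noncomputable def PMF.mean (p : PMF α) (f : α → ℝ) : ℝ := ∑ x, (p x).toReal * f x

namespace PMF

lemma sum_toReal (p : PMF α) : ∑ x, (p x).toReal = 1 := by
  rw [← ENNReal.toReal_sum fun x _ => p.apply_ne_top x, ← tsum_fintype (L := .unconditional _),
    p.tsum_coe, ENNReal.toReal_one]

lemma mean_const (p : PMF α) (c : ℝ) : p.mean (fun _ => c) = c := by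
  simp [mean, ← Finset.sum_mul, p.sum_toReal]

lemma mean_mono (p : PMF α) {f g : α → ℝ} (h : ∀ x, f x ≤ g x) : p.mean f ≤ p.mean g :=
  Finset.sum_le_sum fun x _ => mul_le_mul_of_nonneg_left (h x) ENNReal.toReal_nonneg

lemma mean_le (p : PMF α) {f : α → ℝ} {c : ℝ} (h : ∀ x, f x ≤ c) : p.mean f ≤ c :=
  (p.mean_mono h).trans_eq (p.mean_const c)

lemma le_mean (p : PMF α) {f : α → ℝ} {c : ℝ} (h : ∀ x, c ≤ f x) : c ≤ p.mean f :=
  (p.mean_const c).symm.trans_le (p.mean_mono h)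

lemma mean_add (p : PMF α) (f g : α → ℝ) :
    p.mean (fun x => f x + g x) = p.mean f + p.mean g := by
  simp [mean, mul_add, Finset.sum_add_distrib]

lemma mean_sub (p : PMF α) (f g : α → ℝ) :
    p.mean (fun x => f x - g x) = p.mean f - p.mean g := by
  simp [mean, mul_sub, Finset.sum_sub_distrib]

lemma mean_const_mul (p : PMF α) (c : ℝ) (f : α → ℝ) :
    p.mean (fun x => c * f x) = c * p.mean f := by
  simp [mean, Finset.mul_sum, mul_left_comm]

lemma mean_sum {ι : Type*} (p : PMF α) (t : Finset ι) (f : ι → α → ℝ) :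
    p.mean (fun x => ∑ i ∈ t, f i x) = ∑ i ∈ t, p.mean (f i) := by
  simp only [mean, Finset.mul_sum]
  exact Finset.sum_comm

lemma mean_pure (a : α) (f : α → ℝ) : (PMF.pure a).mean f = f a := by
  classical
  rw [mean, Finset.sum_eq_single a]
  · simp
  · intro b _ hb
    simp [PMF.pure_apply_of_ne _ _ hb]
  · simp

lemma mean_bind (p : PMF α) (g : α → PMF β) (f : β → ℝ) :
    (p.bind g).mean f = p.mean fun x => (g x).mean f := by
  have h (b : β) : ((p.bind g) b).toReal = ∑ a, (p a).toReal * (g a b).toReal := by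
    rw [PMF.bind_apply, tsum_fintype, ENNReal.toReal_sum]
    · simp
    · exact fun a _ => ENNReal.mul_ne_top (p.apply_ne_top _) ((g a).apply_ne_top _)
  simp only [mean, h, Finset.sum_mul, Finset.mul_sum]
  rw [Finset.sum_comm]
  simp only [mul_assoc]

end PMF

end PMFMean

/-! ### Matrix games -/

section MatrixGame

variable {A B : Type*} [Fintype A] [Fintype B]

lemma matrixPayoff_eq_mean (μ : PMF A) (ν : PMF B) (M : A → B → ℝ) :
    matrixPayoff μ ν M = μ.mean fun a => ν.mean (M a) := by
  simp [matrixPayoff, PMF.mean, Finset.mul_sum, mul_assoc]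

lemma matrixPayoff_mono (μ : PMF A) (ν : PMF B) {M M' : A → B → ℝ} (h : ∀ a b, M a b ≤ M' a b) :
    matrixPayoff μ ν M ≤ matrixPayoff μ ν M' := by
  simp only [matrixPayoff_eq_mean]
  exact μ.mean_mono fun a => ν.mean_mono (h a)

lemma matrixPayoff_const (μ : PMF A) (ν : PMF B) (c : ℝ) :
    matrixPayoff μ ν (fun _ _ => c) = c := by
  simp [matrixPayoff_eq_mean, PMF.mean_const]

lemma matrixPayoff_le (μ : PMF A) (ν : PMF B) {M : A → B → ℝ} {c : ℝ} (h : ∀ a b, M a b ≤ c) :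
    matrixPayoff μ ν M ≤ c :=
  (matrixPayoff_mono μ ν h).trans_eq (matrixPayoff_const μ ν c)

lemma le_matrixPayoff (μ : PMF A) (ν : PMF B) {M : A → B → ℝ} {c : ℝ} (h : ∀ a b, c ≤ M a b) :
    c ≤ matrixPayoff μ ν M :=
  (matrixPayoff_const μ ν c).symm.trans_le (matrixPayoff_mono μ ν h)

/-- The value of a matrix game is monotone and commutes with the addition of constants. -/
lemma IsMatrixNash.payoff_le_add {M M' : A → B → ℝ} {μ μ' : PMF A} {ν ν' : PMF B} {c : ℝ}
    (hM : IsMatrixNash M μ ν) (hM' : IsMatrixNash M' μ' ν') (h : ∀ a b, M a b ≤ M' a b + c) :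
    matrixPayoff μ ν M ≤ matrixPayoff μ' ν' M' + c :=
  -- The crossed pair `(μ, ν')` links the two games: it is a deviation of the column player in `M`
  -- and of the row player in `M'`.
  calc matrixPayoff μ ν M ≤ matrixPayoff μ ν' M := hM.2 ν'
    _ ≤ matrixPayoff μ ν' (fun a b => M' a b + c) := matrixPayoff_mono _ _ h
    _ = matrixPayoff μ ν' M' + c := by
      simp only [matrixPayoff_eq_mean, PMF.mean_add, PMF.mean_const]
    _ ≤ matrixPayoff μ' ν' M' + c := by gcongr; exact hM'.1 μ

lemma IsMatrixNash.payoff_mono {M M' : A → B → ℝ} {μ μ' : PMF A} {ν ν' : PMF B}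
    (hM : IsMatrixNash M μ ν) (hM' : IsMatrixNash M' μ' ν') (h : ∀ a b, M a b ≤ M' a b) :
    matrixPayoff μ ν M ≤ matrixPayoff μ' ν' M' := by
  simpa using hM.payoff_le_add (c := 0) hM' (by simpa using h)

/-- The probability with given real weights in the standard simplex. -/
noncomputable def PMF.ofSimplex (x : A → ℝ) (hx : x ∈ stdSimplex ℝ A) : PMF A :=
  PMF.ofFintype (fun a => ENNReal.ofReal (x a)) (by
    rw [← ENNReal.ofReal_sum_of_nonneg fun a _ => hx.1 a, hx.2, ENNReal.ofReal_one])

lemma PMF.toReal_ofSimplex (x : A → ℝ) (hx : x ∈ stdSimplex ℝ A) (a : A) :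
    (PMF.ofSimplex x hx a).toReal = x a := by
  simp [PMF.ofSimplex, hx.1 a]

lemma PMF.toReal_mem_stdSimplex (p : PMF A) : (fun a => (p a).toReal) ∈ stdSimplex ℝ A :=
  ⟨fun _ => ENNReal.toReal_nonneg, p.sum_toReal⟩

/-- Von Neumann's theorem: every matrix game has a Nash equilibrium. -/
theorem exists_isMatrixNash [Nonempty A] [Nonempty B] (M : A → B → ℝ) :
    ∃ p : PMF A × PMF B, IsMatrixNash M p.1 p.2 := by
  let f : (B → ℝ) → (A → ℝ) → ℝ := fun y x => ∑ a, ∑ b, x a * y b * M a b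
  have hlin (y : B → ℝ) : ∃ l : (A → ℝ) →ₗ[ℝ] ℝ, ∀ x, f y x = l x :=
    ⟨{ toFun := f y
       map_add' := fun x x' => by simp [f, add_mul, Finset.sum_add_distrib]
       map_smul' := fun c x => by simp [f, Finset.mul_sum, mul_assoc] }, fun _ => rfl⟩
  have hlin' (x : A → ℝ) : ∃ l : (B → ℝ) →ₗ[ℝ] ℝ, ∀ y, f y x = l y :=
    ⟨{ toFun := fun y => f y x
       map_add' := fun y y' => by simp [f, add_mul, mul_add, Finset.sum_add_distrib]
       map_smul' := fun c y => by simp [f, Finset.mul_sum, mul_assoc, mul_left_comm] },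
      fun _ => rfl⟩
  -- The minimizing variable is the first argument of `f`, so the column player's simplex comes
  -- first.
  obtain ⟨y, hy, x, hx, h⟩ := Sion.exists_isSaddlePointOn (X := stdSimplex ℝ B)
    (Y := stdSimplex ℝ A) (f := f)
    (by classical exact ⟨_, single_mem_stdSimplex ℝ (Classical.arbitrary B)⟩)
    (convex_stdSimplex ℝ B) (isCompact_stdSimplex ℝ B)
    (fun x _ => by
      exact (Continuous.lowerSemicontinuous (by fun_prop)).lowerSemicontinuousOn _)
    (fun x _ => by
      obtain ⟨l, hl⟩ := hlin' x
      simp only [hl]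
      exact (l.convexOn (convex_stdSimplex ℝ B)).quasiconvexOn)
    (convex_stdSimplex ℝ A)
    (by classical exact ⟨_, single_mem_stdSimplex ℝ (Classical.arbitrary A)⟩)
    (isCompact_stdSimplex ℝ A)
    (fun y _ => by
      exact (Continuous.upperSemicontinuous (by fun_prop)).upperSemicontinuousOn _)
    (fun y _ => by
      obtain ⟨l, hl⟩ := hlin y
      simp only [hl]
      exact (l.concaveOn (convex_stdSimplex ℝ A)).quasiconcaveOn)
  refine ⟨(PMF.ofSimplex x hx, PMF.ofSimplex y hy), fun μ' => ?_, fun ν' => ?_⟩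
  · simpa only [matrixPayoff, PMF.toReal_ofSimplex] using h y hy _ μ'.toReal_mem_stdSimplex
  · simpa only [matrixPayoff, PMF.toReal_ofSimplex] using h _ ν'.toReal_mem_stdSimplex x hx

end MatrixGame

/-! ### The discounted game -/

namespace StochasticGame

variable {S A B : Type*} [Fintype S] [Fintype A] [Fintype B] (G : StochasticGame S A B)

/-- The matrix game `r(s, ·, ·) + γ P V (s, ·, ·)`. -/
noncomputable def qValue (γ : ℝ) (V : S → ℝ) (s : S) (a : A) (b : B) : ℝ :=
  G.r s a b + γ * (G.P s a b).mean V

/-- Expected one-step reward of a pair of policies. -/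
noncomputable def policyReward (μ : S → PMF A) (ν : S → PMF B) (s : S) : ℝ :=
  matrixPayoff (μ s) (ν s) (G.r s)

/-- `V` is the value of the `γ`-discounted game, and `μ`, `ν` are optimal policies. -/
def IsDiscountedValue (γ : ℝ) (V : S → ℝ) (μ : S → PMF A) (ν : S → PMF B) : Prop :=
  ∀ s, IsMatrixNash (G.qValue γ V s) (μ s) (ν s) ∧
    matrixPayoff (μ s) (ν s) (G.qValue γ V s) = V s

lemma policyKernel_mean (μ : S → PMF A) (ν : S → PMF B) (s : S) (f : S → ℝ) :
    (G.policyKernel μ ν s).mean f = matrixPayoff (μ s) (ν s) fun a b => (G.P s a b).mean f := by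
  simp only [policyKernel, PMF.mean_bind, matrixPayoff_eq_mean]

lemma matrixPayoff_qValue (γ : ℝ) (V : S → ℝ) (μ : S → PMF A) (ν : S → PMF B) (s : S) :
    matrixPayoff (μ s) (ν s) (G.qValue γ V s) =
      G.policyReward μ ν s + γ * (G.policyKernel μ ν s).mean V := by
  rw [policyKernel_mean, policyReward]
  have h (a : A) : G.qValue γ V s a = fun b => G.r s a b + γ * (G.P s a b).mean V := rfl
  simp only [matrixPayoff_eq_mean, h, PMF.mean_add, PMF.mean_const_mul]

lemma policyReward_nonneg (μ : S → PMF A) (ν : S → PMF B) (s : S) : 0 ≤ G.policyReward μ ν s :=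
  le_matrixPayoff _ _ (G.r_nonneg s)

lemma policyReward_le_one (μ : S → PMF A) (ν : S → PMF B) (s : S) : G.policyReward μ ν s ≤ 1 :=
  matrixPayoff_le _ _ (G.r_le_one s)

/-- The Shapley operator, which solves the matrix game `qValue` in each state, is a `γ`-contraction
for the sup distance because matrix values are monotone and commute with constants. Its fixed point
is `V`. -/
lemma exists_isDiscountedValue [Nonempty A] [Nonempty B] {γ : ℝ} (h0 : 0 ≤ γ) (h1 : γ < 1) :
    ∃ V μ ν, G.IsDiscountedValue γ V μ ν := by
  choose nash hnash using exists_isMatrixNash (A := A) (B := B)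
  let F : (S → ℝ) → S → ℝ := fun V s =>
    matrixPayoff (nash (G.qValue γ V s)).1 (nash (G.qValue γ V s)).2 (G.qValue γ V s)
  have key (V W : S → ℝ) (s : S) : F V s ≤ F W s + γ * dist V W := by
    refine (hnash _).payoff_le_add (hnash _) fun a b => ?_
    have : (G.P s a b).mean V ≤ (G.P s a b).mean W + dist V W := by
      rw [← PMF.mean_const (G.P s a b) (dist V W), ← PMF.mean_add]
      refine PMF.mean_mono _ fun x => ?_
      have := (le_abs_self _).trans (dist_le_pi_dist V W x)
      linarith
    have := mul_le_mul_of_nonneg_left this h0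
    simp only [qValue]
    linarith
  have hF : ContractingWith ⟨γ, h0⟩ F := by
    refine ⟨by exact_mod_cast h1, LipschitzWith.of_dist_le_mul fun V W => ?_⟩
    refine (dist_pi_le_iff (by positivity)).2 fun s => ?_
    rw [Real.dist_eq, abs_le]
    have h₁ := key V W s
    have h₂ := key W V s
    rw [dist_comm W V] at h₂
    change _ ≤ _ ∧ _ ≤ γ * dist V W
    constructor
    · change -(γ * dist V W) ≤ _
      linarith
    · linarith
  exact ⟨hF.fixedPoint, fun s => (nash (G.qValue γ hF.fixedPoint s)).1,
    fun s => (nash (G.qValue γ hF.fixedPoint s)).2, fun s =>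
      ⟨hnash _, congrFun hF.fixedPoint_isFixedPt s⟩⟩

variable {G} {γ : ℝ} {V : S → ℝ} {μ : S → PMF A} {ν : S → PMF B}

namespace IsDiscountedValue

/-- At a minimizer `x` of `V`, nonnegative rewards give `V x ≥ γ V x`. -/
lemma nonneg (hV : G.IsDiscountedValue γ V μ ν) (h0 : 0 ≤ γ) (h1 : γ < 1) (s : S) : 0 ≤ V s := by
  have : Nonempty S := ⟨s⟩
  obtain ⟨x, hx⟩ := Finite.exists_min V
  have h := (hV x).2
  rw [matrixPayoff_qValue] at h
  have h2 := mul_le_mul_of_nonneg_left (PMF.le_mean (G.policyKernel μ ν x) hx) h0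
  have h3 := G.policyReward_nonneg μ ν x
  have : 0 ≤ V x := by
    by_contra hneg
    nlinarith
  exact this.trans (hx s)

lemma one_sub_mul_le_one (hV : G.IsDiscountedValue γ V μ ν) (h0 : 0 ≤ γ) (h1 : γ < 1) (s : S) :
    (1 - γ) * V s ≤ 1 := by
  have : Nonempty S := ⟨s⟩
  obtain ⟨x, hx⟩ := Finite.exists_max V
  have h := (hV x).2
  rw [matrixPayoff_qValue] at h
  have h2 := mul_le_mul_of_nonneg_left (PMF.mean_le (G.policyKernel μ ν x) hx) h0
  have h3 := G.policyReward_le_one μ ν x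
  have h4 := mul_le_mul_of_nonneg_left (hx s) (sub_nonneg.2 h1.le)
  linarith

/-- The optimal policy of the max-player guarantees `V`. -/
lemma le_reward_add (hV : G.IsDiscountedValue γ V μ ν) (ν' : S → PMF B) (s : S) :
    V s ≤ G.policyReward μ ν' s + γ * (G.policyKernel μ ν' s).mean V := by
  rw [← matrixPayoff_qValue, ← (hV s).2]
  exact (hV s).1.2 _

/-- The optimal policy of the min-player guarantees `V`. -/
lemma reward_add_le (hV : G.IsDiscountedValue γ V μ ν) (μ' : S → PMF A) (s : S) :
    G.policyReward μ' ν s + γ * (G.policyKernel μ' ν s).mean V ≤ V s := by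
  rw [← matrixPayoff_qValue, ← (hV s).2]
  exact (hV s).1.1 _

end IsDiscountedValue

/-! ### Span of the discounted value -/

section HittingTime

variable [DecidableEq S]

lemma avoidProb_le_one (G : StochasticGame S A B) (μ : S → PMF A) (ν : S → PMF B) (s' : S) (n : ℕ)
    (s : S) : G.avoidProb μ ν s' n s ≤ 1 := by
  induction n generalizing s with
  | zero => rw [avoidProb]; split_ifs <;> simp
  | succ n ih =>
    rw [avoidProb]
    split_ifs
    · simp
    · calc ∑' x, G.policyKernel μ ν s x * G.avoidProb μ ν s' n x
          ≤ ∑' x, G.policyKernel μ ν s x * 1 :=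
            ENNReal.tsum_le_tsum fun x => by gcongr; exact ih x
        _ = 1 := by simp only [mul_one, PMF.tsum_coe]

lemma avoidProb_ne_top (G : StochasticGame S A B) (μ : S → PMF A) (ν : S → PMF B) (s' : S) (n : ℕ)
    (s : S) : G.avoidProb μ ν s' n s ≠ ⊤ :=
  ne_top_of_le_ne_top ENNReal.one_ne_top (G.avoidProb_le_one μ ν s' n s)

lemma toReal_avoidProb_succ (G : StochasticGame S A B) (μ : S → PMF A) (ν : S → PMF B) {s s' : S}
    (h : s ≠ s') (n : ℕ) : (G.avoidProb μ ν s' (n + 1) s).toReal =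
      (G.policyKernel μ ν s).mean fun x => (G.avoidProb μ ν s' n x).toReal := by
  rw [avoidProb, if_neg h, tsum_fintype, ENNReal.toReal_sum]
  · simp [PMF.mean]
  · exact fun x _ => ENNReal.mul_ne_top (PMF.apply_ne_top _ _) (G.avoidProb_ne_top μ ν s' n x)

lemma toReal_avoidProb_self (G : StochasticGame S A B) (μ : S → PMF A) (ν : S → PMF B) (s : S)
    (n : ℕ) : (G.avoidProb μ ν s n s).toReal = 0 := by
  cases n <;> simp [avoidProb]

lemma toReal_avoidProb_zero (G : StochasticGame S A B) (μ : S → PMF A) (ν : S → PMF B) {s s' : S}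
    (h : s ≠ s') : (G.avoidProb μ ν s' 0 s).toReal = 1 := by
  simp [avoidProb, h]

/-- Against the optimal `ν`, `V ≥ γ P V` for any `μ'`, since rewards are nonnegative. Following the
chain until the hitting time `τ` of `s'`, or until time `n`, the value decays by at most `γ^τ ≥ 1 -
(1-γ) τ`. The sum is `E[min(τ, n)]`, and the last term discards the paths that have not arrived. -/
lemma IsDiscountedValue.ge_of_avoidProb (hV : G.IsDiscountedValue γ V μ ν) (h0 : 0 ≤ γ)
    (h1 : γ < 1) (μ' : S → PMF A) (s' : S) (n : ℕ) (s : S) :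
    V s' * (1 - (1 - γ) * ∑ k ∈ Finset.range n, (G.avoidProb μ' ν s' k s).toReal
      - (G.avoidProb μ' ν s' n s).toReal) ≤ V s := by
  induction n generalizing s with
  | zero =>
    by_cases h : s = s'
    · subst h
      simp [toReal_avoidProb_self]
    · simpa [toReal_avoidProb_zero _ _ _ h] using hV.nonneg h0 h1 s
  | succ n ih =>
    by_cases h : s = s'
    · subst h
      simp [toReal_avoidProb_self]
    · have h2 := PMF.mean_mono (G.policyKernel μ' ν s) ih
      rw [PMF.mean_const_mul, PMF.mean_sub, PMF.mean_sub, PMF.mean_const, PMF.mean_const_mul,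
        PMF.mean_sum] at h2
      simp only [← toReal_avoidProb_succ G μ' ν h] at h2
      have h3 := hV.reward_add_le μ' s
      have h4 := G.policyReward_nonneg μ' ν s
      rw [Finset.sum_range_succ', toReal_avoidProb_zero _ _ _ h]
      set x := ∑ k ∈ Finset.range n, (G.avoidProb μ' ν s' (k + 1) s).toReal
      set y := (G.avoidProb μ' ν s' (n + 1) s).toReal
      have hx : 0 ≤ x := Finset.sum_nonneg fun _ _ => ENNReal.toReal_nonneg
      have hy : 0 ≤ y := ENNReal.toReal_nonneg
      have h5 := mul_le_mul_of_nonneg_left h2 h0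
      have h6 : 0 ≤ V s' * ((1 - γ) * ((1 - γ) * x + y)) := by
        have := hV.nonneg h0 h1 s'
        have := sub_nonneg.2 h1.le
        positivity
      nlinarith

/-- The values of the discounted game in two states differ at most by the diameter. -/
lemma IsDiscountedValue.le_add_of_diameter_le (hV : G.IsDiscountedValue γ V μ ν) (h0 : 0 ≤ γ)
    (h1 : γ < 1) {D : ℝ} (hD : 0 ≤ D) (hG : G.diameter ≤ ENNReal.ofReal D) (s s' : S) :
    V s' ≤ V s + D := by
  -- The infimum over `μ` in the diameter need not be attained, hence the slack `η`.
  refine le_of_forall_pos_le_add fun η hη => ?_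
  have h2 : ⨅ μ' : S → PMF A, G.expectedHittingTime μ' ν s s' < ENNReal.ofReal (D + η) := by
    refine lt_of_le_of_lt (le_trans ?_ hG) ((ENNReal.ofReal_lt_ofReal_iff (by linarith)).2
      (by linarith))
    exact (le_iSup (fun ν : S → PMF B => ⨅ μ' : S → PMF A, G.expectedHittingTime μ' ν s s') ν).trans
      ((le_iSup (fun s' => ⨆ ν : S → PMF B, ⨅ μ' : S → PMF A,
        G.expectedHittingTime μ' ν s s') s').trans
        (le_iSup (fun s => ⨆ (s' : S) (ν : S → PMF B), ⨅ μ' : S → PMF A,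
          G.expectedHittingTime μ' ν s s') s))
  obtain ⟨μ', hμ'⟩ := iInf_lt_iff.1 h2
  have hne : G.expectedHittingTime μ' ν s s' ≠ ⊤ := ne_top_of_lt hμ'
  have hsum : Summable fun k => (G.avoidProb μ' ν s' k s).toReal := ENNReal.summable_toReal hne
  have htsum : ∑' k, (G.avoidProb μ' ν s' k s).toReal ≤ D + η := by
    rw [← ENNReal.tsum_toReal_eq fun k => G.avoidProb_ne_top μ' ν s' k s]
    exact ENNReal.toReal_le_of_le_ofReal (by linarith) hμ'.le
  have hlim : Tendsto (fun n => V s' * (1 - (1 - γ) *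
      ∑ k ∈ Finset.range n, (G.avoidProb μ' ν s' k s).toReal
      - (G.avoidProb μ' ν s' n s).toReal)) atTop
      (nhds (V s' * (1 - (1 - γ) * ∑' k, (G.avoidProb μ' ν s' k s).toReal - 0))) :=
    ((tendsto_const_nhds.sub (hsum.hasSum.tendsto_sum_nat.const_mul _)).sub
      hsum.tendsto_atTop_zero).const_mul _
  have h3 := le_of_tendsto' hlim fun n => hV.ge_of_avoidProb h0 h1 μ' s' n s
  have h4 := hV.one_sub_mul_le_one h0 h1 s'
  have h5 := hV.nonneg h0 h1 s'
  have h6 : 0 ≤ ∑' k, (G.avoidProb μ' ν s' k s).toReal :=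
    tsum_nonneg fun _ => ENNReal.toReal_nonneg
  -- In the limit `V s' - V s ≤ (1-γ) V s' · E[τ]`, and `(1-γ) V s' ≤ 1`.
  nlinarith [mul_le_mul_of_nonneg_right h4 h6]

end HittingTime

/-! ### Existence of the average value -/

section AverageReward

lemma averageReward_eq (G : StochasticGame S A B) (μ : S → PMF A) (ν : S → PMF B) (s : S) :
    G.averageReward μ ν s = liminf (fun T : ℕ => (∑ t ∈ Finset.range T,
      (G.stateLaw μ ν s t).mean (G.policyReward μ ν)) / (T : ℝ)) atTop := rfl

lemma average_mem_Icc (G : StochasticGame S A B) (μ : S → PMF A) (ν : S → PMF B) (s : S) (T : ℕ) :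
    (∑ t ∈ Finset.range T, (G.stateLaw μ ν s t).mean (G.policyReward μ ν)) / (T : ℝ)
      ∈ Set.Icc (0 : ℝ) 1 := by
  have h0 : 0 ≤ ∑ t ∈ Finset.range T, (G.stateLaw μ ν s t).mean (G.policyReward μ ν) :=
    Finset.sum_nonneg fun t _ => PMF.le_mean _ (G.policyReward_nonneg μ ν)
  refine ⟨by positivity, div_le_one_of_le₀ ?_ (by positivity)⟩
  calc _ ≤ ∑ t ∈ Finset.range T, (1 : ℝ) :=
        Finset.sum_le_sum fun t _ => PMF.mean_le _ (G.policyReward_le_one μ ν)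
    _ = T := by simp

/-- `W` acts as a potential: summing the hypothesis along the chain telescopes, and the boundary
term is bounded, so it disappears after division by `T`. -/
lemma le_averageReward (G : StochasticGame S A B) (μ : S → PMF A) (ν : S → PMF B) (W : S → ℝ)
    (c : ℝ) (h : ∀ s, W s + c ≤ G.policyReward μ ν s + (G.policyKernel μ ν s).mean W) (s : S) :
    c ≤ G.averageReward μ ν s := by
  obtain ⟨C, hC⟩ : ∃ C, ∀ x, W x ≤ C := by
    obtain ⟨x, hx⟩ := @Finite.exists_max _ _ _ ⟨s⟩ _ W
    exact ⟨_, hx⟩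
  have hsum (T : ℕ) : W s - C + T * c ≤
      ∑ t ∈ Finset.range T, (G.stateLaw μ ν s t).mean (G.policyReward μ ν) := by
    have : W s - (G.stateLaw μ ν s T).mean W + T * c ≤
        ∑ t ∈ Finset.range T, (G.stateLaw μ ν s t).mean (G.policyReward μ ν) := by
      induction T with
      | zero => simp [stateLaw, PMF.mean_pure]
      | succ T ih =>
        have h2 := PMF.mean_mono (G.stateLaw μ ν s T) h
        rw [PMF.mean_add, PMF.mean_add, PMF.mean_const, ← PMF.mean_bind] at h2
        rw [Finset.sum_range_succ]
        simp only [stateLaw]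
        push_cast
        linarith
    have := PMF.mean_le (G.stateLaw μ ν s T) hC
    linarith
  have hlim : Tendsto (fun T : ℕ => (W s - C) / (T : ℝ) + c) atTop (nhds (0 + c)) :=
    (tendsto_const_div_atTop_nhds_zero_nat _).add_const c
  rw [zero_add] at hlim
  rw [averageReward_eq, ← hlim.liminf_eq]
  refine liminf_le_liminf ?_ hlim.isBoundedUnder_ge ?_
  · filter_upwards [eventually_gt_atTop 0] with T hT
    have : (0 : ℝ) < T := by exact_mod_cast hT
    rw [le_div_iff₀ this]
    calc _ = W s - C + T * c := by field_simp
      _ ≤ _ := hsum T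
  · exact (isBoundedUnder_of ⟨1, fun T => (G.average_mem_Icc μ ν s T).2⟩).isCoboundedUnder_ge

lemma averageReward_le (G : StochasticGame S A B) (μ : S → PMF A) (ν : S → PMF B) (W : S → ℝ)
    (c : ℝ) (h : ∀ s, G.policyReward μ ν s + (G.policyKernel μ ν s).mean W ≤ W s + c) (s : S) :
    G.averageReward μ ν s ≤ c := by
  obtain ⟨C, hC⟩ : ∃ C, ∀ x, C ≤ W x := by
    obtain ⟨x, hx⟩ := @Finite.exists_min _ _ _ ⟨s⟩ _ W
    exact ⟨_, hx⟩
  have hsum (T : ℕ) : ∑ t ∈ Finset.range T, (G.stateLaw μ ν s t).mean (G.policyReward μ ν) ≤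
      W s - C + T * c := by
    have : ∑ t ∈ Finset.range T, (G.stateLaw μ ν s t).mean (G.policyReward μ ν) ≤
        W s - (G.stateLaw μ ν s T).mean W + T * c := by
      induction T with
      | zero => simp [stateLaw, PMF.mean_pure]
      | succ T ih =>
        have h2 := PMF.mean_mono (G.stateLaw μ ν s T) h
        rw [PMF.mean_add, PMF.mean_add, PMF.mean_const, ← PMF.mean_bind] at h2
        rw [Finset.sum_range_succ]
        simp only [stateLaw]
        push_cast
        linarith
    have := PMF.le_mean (G.stateLaw μ ν s T) hC
    linarith
  have hlim : Tendsto (fun T : ℕ => (W s - C) / (T : ℝ) + c) atTop (nhds (0 + c)) :=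
    (tendsto_const_div_atTop_nhds_zero_nat _).add_const c
  rw [zero_add] at hlim
  rw [averageReward_eq, ← hlim.liminf_eq]
  refine liminf_le_liminf ?_ ?_ hlim.isBoundedUnder_le.isCoboundedUnder_ge
  · filter_upwards [eventually_gt_atTop 0] with T hT
    have : (0 : ℝ) < T := by exact_mod_cast hT
    rw [div_le_iff₀ this]
    calc _ ≤ W s - C + T * c := hsum T
      _ = _ := by field_simp
  · exact isBoundedUnder_of ⟨0, fun T => (G.average_mem_Icc μ ν s T).1⟩

lemma averageReward_nonneg (G : StochasticGame S A B) (μ : S → PMF A) (ν : S → PMF B) (s : S) :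
    0 ≤ G.averageReward μ ν s :=
  G.le_averageReward μ ν 0 0 (fun x => by
    simpa [PMF.mean] using G.policyReward_nonneg μ ν x) s

lemma averageReward_le_one (G : StochasticGame S A B) (μ : S → PMF A) (ν : S → PMF B) (s : S) :
    G.averageReward μ ν s ≤ 1 :=
  G.averageReward_le μ ν 0 1 (fun x => by
    simpa [PMF.mean] using G.policyReward_le_one μ ν x) s

/-- This bound and the next ones make the real `⨅` and `⨆` genuine; on unbounded families they would
take a default value. -/
lemma bddBelow_averageReward (G : StochasticGame S A B) (μ : S → PMF A) (s : S) :
    BddBelow (Set.range fun ν : S → PMF B => G.averageReward μ ν s) :=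
  ⟨0, by rintro _ ⟨ν, rfl⟩; exact G.averageReward_nonneg μ ν s⟩

lemma bddAbove_averageReward (G : StochasticGame S A B) (ν : S → PMF B) (s : S) :
    BddAbove (Set.range fun μ : S → PMF A => G.averageReward μ ν s) :=
  ⟨1, by rintro _ ⟨μ, rfl⟩; exact G.averageReward_le_one μ ν s⟩

variable [Nonempty A] [Nonempty B]

lemma bddAbove_iInf_averageReward (G : StochasticGame S A B) (s : S) :
    BddAbove (Set.range fun μ : S → PMF A => ⨅ ν : S → PMF B, G.averageReward μ ν s) := by
  refine ⟨1, ?_⟩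
  rintro _ ⟨μ, rfl⟩
  exact (ciInf_le (G.bddBelow_averageReward μ s) fun _ => PMF.uniformOfFintype B).trans
    (G.averageReward_le_one _ _ s)

lemma bddBelow_iSup_averageReward (G : StochasticGame S A B) (s : S) :
    BddBelow (Set.range fun ν : S → PMF B => ⨆ μ : S → PMF A, G.averageReward μ ν s) := by
  refine ⟨0, ?_⟩
  rintro _ ⟨ν, rfl⟩
  exact (G.averageReward_nonneg (fun _ => PMF.uniformOfFintype A) _ s).trans
    (le_ciSup (G.bddAbove_averageReward ν s) fun _ => PMF.uniformOfFintype A)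

lemma iSup_iInf_averageReward_le (G : StochasticGame S A B) (s : S) :
    ⨆ μ : S → PMF A, ⨅ ν : S → PMF B, G.averageReward μ ν s ≤
      ⨅ ν : S → PMF B, ⨆ μ : S → PMF A, G.averageReward μ ν s := by
  have : Nonempty (S → PMF A) := ⟨fun _ => PMF.uniformOfFintype A⟩
  have : Nonempty (S → PMF B) := ⟨fun _ => PMF.uniformOfFintype B⟩
  exact ciSup_le fun μ => le_ciInf fun ν => (ciInf_le (G.bddBelow_averageReward μ s) ν).trans
    (le_ciSup (G.bddAbove_averageReward ν s) μ)

/-- The discounted inequality `V ≤ r + γ P V` reads `V + (1-γ) P V ≤ r + P V`, and `P V ≥ c`: `V` is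
a potential for the undiscounted chain. -/
lemma IsDiscountedValue.le_iSup_iInf (hV : G.IsDiscountedValue γ V μ ν) (h1 : γ < 1) {c : ℝ}
    (hc : ∀ x, c ≤ V x) (s : S) :
    (1 - γ) * c ≤ ⨆ μ : S → PMF A, ⨅ ν : S → PMF B, G.averageReward μ ν s := by
  have : Nonempty (S → PMF B) := ⟨fun _ => PMF.uniformOfFintype B⟩
  refine le_trans (le_ciInf fun ν' => ?_) (le_ciSup (G.bddAbove_iInf_averageReward s) μ)
  refine G.le_averageReward μ ν' V _ (fun x => ?_) s
  have h2 := hV.le_reward_add ν' x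
  have h3 := mul_le_mul_of_nonneg_left (PMF.le_mean (G.policyKernel μ ν' x) hc)
    (sub_nonneg.2 h1.le)
  linarith

lemma IsDiscountedValue.iInf_iSup_le (hV : G.IsDiscountedValue γ V μ ν) (h1 : γ < 1) {c : ℝ}
    (hc : ∀ x, V x ≤ c) (s : S) :
    ⨅ ν : S → PMF B, ⨆ μ : S → PMF A, G.averageReward μ ν s ≤ (1 - γ) * c := by
  have : Nonempty (S → PMF A) := ⟨fun _ => PMF.uniformOfFintype A⟩
  refine (ciInf_le (G.bddBelow_iSup_averageReward s) ν).trans (ciSup_le fun μ' => ?_)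
  refine G.averageReward_le μ' ν V _ (fun x => ?_) s
  have h2 := hV.reward_add_le μ' x
  have h3 := mul_le_mul_of_nonneg_left (PMF.mean_le (G.policyKernel μ' ν x) hc)
    (sub_nonneg.2 h1.le)
  linarith

/-- A game of finite diameter has an average value, which the discounted values approximate. -/
theorem exists_isAverageValue [DecidableEq S] [Nonempty S] (G : StochasticGame S A B) {D : ℝ}
    (hD : 0 ≤ D) (hG : G.diameter ≤ ENNReal.ofReal D) :
    ∃ J, G.IsAverageValue J ∧ ∀ γ V μ ν, 0 ≤ γ → γ < 1 → G.IsDiscountedValue γ V μ ν →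
      ∀ s, J ≤ (1 - γ) * (V s + D) := by
  obtain ⟨s₀⟩ := ‹Nonempty S›
  set lo : S → ℝ := fun s => ⨆ μ : S → PMF A, ⨅ ν : S → PMF B, G.averageReward μ ν s with hlo
  set hi : S → ℝ := fun s => ⨅ ν : S → PMF B, ⨆ μ : S → PMF A, G.averageReward μ ν s with hhi
  have hle (s : S) : lo s ≤ hi s := G.iSup_iInf_averageReward_le s
  have hgap (s s' : S) : hi s ≤ lo s' := by
    refine le_of_forall_pos_le_add fun η hη => ?_
    obtain ⟨γ, h0, h1, hγ⟩ : ∃ γ : ℝ, 0 ≤ γ ∧ γ < 1 ∧ (1 - γ) * D ≤ η := by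
      -- The denominator `D + 1` allows `D = 0`; the minimum with `1` keeps `γ ≥ 0`.
      refine ⟨1 - min 1 (η / (D + 1)), by simp, by simp; positivity, ?_⟩
      calc _ = min 1 (η / (D + 1)) * D := by ring
        _ ≤ η / (D + 1) * (D + 1) := by
          gcongr
          · exact min_le_right _ _
          · linarith
        _ = η := by field_simp
    obtain ⟨V, μ, ν, hV⟩ := G.exists_isDiscountedValue h0 h1
    obtain ⟨x, hx⟩ := @Finite.exists_min _ _ _ ⟨s₀⟩ _ V
    have h2 := hV.le_iSup_iInf h1 hx s'
    have h3 := hV.iInf_iSup_le h1 (c := V x + D)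
      (fun y => hV.le_add_of_diameter_le h0 h1 hD hG x y) s
    simp only [hlo, hhi]
    linarith
  refine ⟨hi s₀, fun s => ⟨?_, ?_⟩, ?_⟩
  · exact le_antisymm ((hle s).trans ((hgap s s₀).trans (hle s₀))) (hgap s₀ s)
  · exact le_antisymm ((hgap s s₀).trans (hle s₀)) ((hgap s₀ s).trans (hle s))
  · intro γ V μ ν h0 h1 hV s
    exact hV.iInf_iSup_le h1 (fun y => hV.le_add_of_diameter_le h0 h1 hD hG s y) s₀

end AverageReward

end StochasticGame

/-! ### Expectations on infinite types, with values in `ℝ≥0∞` -/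

section ENNRealExpectation

namespace PMF

variable {α β : Type*}

lemma tsum_bind_mul (p : PMF α) (g : α → PMF β) (f : β → ℝ≥0∞) :
    ∑' y, p.bind g y * f y = ∑' x, p x * ∑' y, g x y * f y := by
  simp only [PMF.bind_apply, ← ENNReal.tsum_mul_right, ← ENNReal.tsum_mul_left]
  rw [ENNReal.tsum_comm]
  simp only [mul_assoc]

lemma tsum_pure_mul (a : α) (f : α → ℝ≥0∞) : ∑' x, PMF.pure a x * f x = f a := by
  rw [tsum_eq_single a fun x hx => by simp [PMF.pure_apply_of_ne _ _ hx]]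
  simp

lemma tsum_map_mul (p : PMF α) (g : α → β) (f : β → ℝ≥0∞) :
    ∑' y, p.map g y * f y = ∑' x, p x * f (g x) := by
  simp only [PMF.map, tsum_bind_mul, Function.comp_apply, tsum_pure_mul]

lemma tsum_mul_ofReal [Fintype α] (p : PMF α) (f : α → ℝ) (hf : ∀ x, 0 ≤ f x) :
    ∑' x, p x * ENNReal.ofReal (f x) = ENNReal.ofReal (p.mean f) := by
  rw [tsum_fintype, mean, ENNReal.ofReal_sum_of_nonneg
    fun x _ => mul_nonneg ENNReal.toReal_nonneg (hf x)]
  refine Finset.sum_congr rfl fun x _ => ?_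
  rw [ENNReal.ofReal_mul ENNReal.toReal_nonneg, ENNReal.ofReal_toReal (p.apply_ne_top x)]

/-- Markov's inequality. -/
lemma toOuterMeasure_le_tsum (p : PMF α) (s : Set α) (f : α → ℝ≥0∞) (hf : ∀ x ∈ s, 1 ≤ f x) :
    p.toOuterMeasure s ≤ ∑' x, p x * f x := by
  rw [PMF.toOuterMeasure_apply]
  refine ENNReal.tsum_le_tsum fun x => ?_
  by_cases hx : x ∈ s
  · rw [Set.indicator_of_mem hx]
    exact le_mul_of_one_le_right zero_le (hf x hx)
  · simp [Set.indicator_of_notMem hx]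

end PMF

end ENNRealExpectation

/-! ### Exponential moment inequalities -/

section ExponentialMoments

/-- Hoeffding's lemma. -/
lemma PMF.mean_exp_le {α : Type*} [Fintype α] (p : PMF α) (f : α → ℝ) {D : ℝ}
    (hf : ∀ x y, f x ≤ f y + D) (c : ℝ) :
    p.mean (fun x => Real.exp (c * (f x - p.mean f))) ≤ Real.exp (c ^ 2 * D ^ 2 / 8) := by
  obtain ⟨x₀, -⟩ := p.support_nonempty
  have : Nonempty α := ⟨x₀⟩
  obtain ⟨y, hy⟩ := Finite.exists_min f
  let _ : MeasurableSpace α := ⊤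
  have hD : 0 ≤ D := by linarith [hf y y]
  have h := ProbabilityTheory.hasSubgaussianMGF_of_mem_Icc (μ := p.toMeasure) (X := f)
    (a := f y) (b := f y + D) (measurable_of_finite f).aemeasurable
    (Eventually.of_forall fun x => ⟨hy x, hf x y⟩)
  have h2 := h.mgf_le c
  rw [ProbabilityTheory.mgf, PMF.integral_eq_sum, PMF.integral_eq_sum] at h2
  simp only [smul_eq_mul, add_sub_cancel_left] at h2
  refine h2.trans_eq ?_
  congr 1
  simp only [NNReal.coe_pow, NNReal.coe_div, coe_nnnorm, Real.norm_eq_abs, abs_of_nonneg hD,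
    NNReal.coe_ofNat]
  ring

/-- With `y = x - 2x²`, the bound `exp y ≤ 1 + y + y²` equals `1 + x - x² (1 + 4x - 4x²)`. -/
lemma Real.exp_sub_two_mul_sq_le {x : ℝ} (hx : |x| ≤ 1 / 10) :
    Real.exp (x - 2 * x ^ 2) ≤ 1 + x := by
  obtain ⟨h1, h2⟩ := abs_le.1 hx
  have hy : |x - 2 * x ^ 2| ≤ 1 := abs_le.2 ⟨by nlinarith, by nlinarith⟩
  have := (abs_le.1 (Real.abs_exp_sub_one_sub_id_le hy)).2
  nlinarith [sq_nonneg x, mul_nonneg (sq_nonneg x) (by nlinarith : 0 ≤ 1 + 4 * x - 4 * x ^ 2)]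

/-- Exponential inequality for the fluctuation of the payoff `M a b` of random actions; the
compensator only involves the realized square and the square of the mean. -/
lemma mean_exp_matrixPayoff_sub_le {A B : Type*} [Fintype A] [Fintype B] (μ : PMF A) (ν : PMF B)
    (M : A → B → ℝ) {H c : ℝ} (h0 : ∀ a b, 0 ≤ M a b) (hH : ∀ a b, M a b ≤ H) (hc : 0 ≤ c)
    (hcH : c * H ≤ 1 / 20) :
    μ.mean (fun a => ν.mean fun b => Real.exp (c * (matrixPayoff μ ν M - M a b)
      - 4 * c ^ 2 * (M a b ^ 2 - matrixPayoff μ ν M ^ 2))) ≤ 1 := by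
  set m := matrixPayoff μ ν M with hm
  have hm0 : 0 ≤ m := le_matrixPayoff μ ν h0
  have hmH : m ≤ H := matrixPayoff_le μ ν hH
  have hcm : c * m ≤ 1 / 20 := (mul_le_mul_of_nonneg_left hmH hc).trans hcH
  have hcm0 : 0 ≤ c * m := mul_nonneg hc hm0
  -- As `M² - m² = (M - m)² + 2m (M - m)`, the linear part of the compensator shifts the coefficient
  -- of `M - m` from `c` to `η`, while a true square `4c² (M - m)²` remains.
  set η := c + 8 * c ^ 2 * m with hη
  have hη0 : 0 ≤ η := by positivity
  have hηc : η ≤ 7 / 5 * c := by nlinarith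
  have key (a : A) (b : B) : Real.exp (c * (m - M a b) - 4 * c ^ 2 * (M a b ^ 2 - m ^ 2)) ≤
      1 + η * m - η * M a b := by
    have hx : |-(η * (M a b - m))| ≤ 1 / 10 := by
      have h1 : |M a b - m| ≤ H := abs_le.2 ⟨by linarith [h0 a b], by linarith [hH a b]⟩
      rw [abs_neg, abs_mul, abs_of_nonneg hη0]
      calc η * |M a b - m| ≤ 7 / 5 * c * H := by gcongr
        _ ≤ 1 / 10 := by linarith
    refine le_trans (Real.exp_le_exp.2 ?_) ((Real.exp_sub_two_mul_sq_le hx).trans_eq (by ring))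
    -- `2 · (7/5)² = 98/25 < 4`: the remaining square pays for the `2x²` needed with `x = -η (M -
    -- m)`. The resulting linear bound has mean `1`.
    have h2 : 2 * η ^ 2 ≤ 4 * c ^ 2 := by nlinarith
    have h3 := mul_le_mul_of_nonneg_right h2 (sq_nonneg (M a b - m))
    have h4 : c * (m - M a b) - 4 * c ^ 2 * (M a b ^ 2 - m ^ 2) =
      -(η * (M a b - m)) - 4 * c ^ 2 * (M a b - m) ^ 2 := by rw [hη]; ring
    rw [h4]
    nlinarith
  refine (μ.mean_mono fun a => ν.mean_mono (key a)).trans_eq ?_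
  simp only [PMF.mean_sub, PMF.mean_const, PMF.mean_const_mul]
  rw [← matrixPayoff_eq_mean, ← hm]
  ring

end ExponentialMoments

/-! ### Exponential supermartingales along histories -/

namespace DONQ

variable {S A B : Type*}

/-- Sum along a history of a quantity attached to each step. -/
noncomputable def pathSum (inc : List (S × A × B) → S → A → B → S → ℝ) : List (S × A × B) → S → ℝ
  | [], _ => 0
  | (s, a, b) :: l, s' => pathSum inc l s + inc l s a b s'

variable [Fintype S] [Fintype A] [Fintype B] [DecidableEq S] [DecidableEq A] [DecidableEq B]
  [Nonempty A] (G : StochasticGame S A B) (nash : (A → B → ℝ) → PMF A × PMF B) (D H δ : ℝ) (T : ℕ)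
  (opp : List (S × A × B) → S → PMF B) (s₁ : S)

/-- Conditional expectation, given a history, of a quantity attached to the next step. -/
noncomputable def stepMean (l : List (S × A × B)) (s : S) (f : A → B → S → ℝ) : ℝ :=
  ((estimate G nash D H δ T l s).μ s).mean fun a => (opp l s).mean fun b => (G.P s a b).mean (f a b)

/-- Supermartingale property: conditioning on the history factors the exponential of the past out of
the last step. -/
lemma tsum_historyLaw_exp_le_one (inc : List (S × A × B) → S → A → B → S → ℝ)
    (h : ∀ l s, stepMean G nash D H δ T opp l s (fun a b s' => Real.exp (inc l s a b s')) ≤ 1)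
    (n : ℕ) : ∑' x, historyLaw G nash D H δ T opp s₁ n x *
      ENNReal.ofReal (Real.exp (pathSum inc x.1 x.2)) ≤ 1 := by
  induction n with
  | zero => simp [historyLaw, pathSum]
  | succ n ih =>
    refine le_trans ?_ ih
    rw [historyLaw, PMF.tsum_bind_mul]
    refine ENNReal.tsum_le_tsum fun x => ?_
    gcongr
    simp only [PMF.tsum_bind_mul, PMF.tsum_map_mul, pathSum, Real.exp_add]
    set C := Real.exp (pathSum inc x.1 x.2) with hC
    have hC0 : 0 ≤ C := (Real.exp_pos _).le
    have e1 (a : A) (b : B) : ∑' s', G.P x.2 a b s' *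
        ENNReal.ofReal (C * Real.exp (inc x.1 x.2 a b s')) =
        ENNReal.ofReal (C * (G.P x.2 a b).mean fun s' => Real.exp (inc x.1 x.2 a b s')) := by
      rw [PMF.tsum_mul_ofReal _ _ fun s' => by positivity, PMF.mean_const_mul]
    have n1 (a : A) (b : B) : 0 ≤ (G.P x.2 a b).mean fun s' => Real.exp (inc x.1 x.2 a b s') :=
      PMF.le_mean _ fun _ => (Real.exp_pos _).le
    have n2 (a : A) : 0 ≤ (opp x.1 x.2).mean fun b =>
        (G.P x.2 a b).mean fun s' => Real.exp (inc x.1 x.2 a b s') := PMF.le_mean _ (n1 a)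
    simp only [e1]
    have e2 (a : A) : ∑' b, opp x.1 x.2 b * ENNReal.ofReal (C *
        (G.P x.2 a b).mean fun s' => Real.exp (inc x.1 x.2 a b s')) =
        ENNReal.ofReal (C * (opp x.1 x.2).mean fun b =>
          (G.P x.2 a b).mean fun s' => Real.exp (inc x.1 x.2 a b s')) := by
      rw [PMF.tsum_mul_ofReal _ _ fun b => mul_nonneg hC0 (n1 a b), PMF.mean_const_mul]
    simp only [e2]
    rw [PMF.tsum_mul_ofReal _ _ fun a => mul_nonneg hC0 (n2 a), PMF.mean_const_mul]
    refine ENNReal.ofReal_le_ofReal ?_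
    exact mul_le_of_le_one_right hC0 (h x.1 x.2)

/-- Chernoff bound for exponential supermartingales along a history. -/
lemma historyLaw_le_pathSum_le (inc : List (S × A × B) → S → A → B → S → ℝ)
    (h : ∀ l s, stepMean G nash D H δ T opp l s (fun a b s' => Real.exp (inc l s a b s')) ≤ 1)
    (n : ℕ) (x : ℝ) :
    (historyLaw G nash D H δ T opp s₁ n).toOuterMeasure {h | x ≤ pathSum inc h.1 h.2} ≤
      ENNReal.ofReal (Real.exp (-x)) := by
  calc _ ≤ ∑' y, historyLaw G nash D H δ T opp s₁ n y *
        (ENNReal.ofReal (Real.exp (pathSum inc y.1 y.2)) * ENNReal.ofReal (Real.exp (-x))) := by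
        refine PMF.toOuterMeasure_le_tsum _ _ _ fun y hy => ?_
        rw [← ENNReal.ofReal_mul (Real.exp_pos _).le, ← Real.exp_add, ENNReal.one_le_ofReal]
        have : x ≤ pathSum inc y.1 y.2 := hy
        exact Real.one_le_exp (by linarith)
    _ = (∑' y, historyLaw G nash D H δ T opp s₁ n y *
        ENNReal.ofReal (Real.exp (pathSum inc y.1 y.2))) * ENNReal.ofReal (Real.exp (-x)) := by
        rw [← ENNReal.tsum_mul_right]
        simp only [mul_assoc]
    _ ≤ 1 * ENNReal.ofReal (Real.exp (-x)) := by
        gcongr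
        exact tsum_historyLaw_exp_le_one G nash D H δ T opp s₁ inc h n
    _ = _ := one_mul _

lemma length_of_mem_support (n : ℕ) (x : List (S × A × B) × S)
    (hx : x ∈ (historyLaw G nash D H δ T opp s₁ n).support) : x.1.length = n := by
  induction n generalizing x with
  | zero =>
    rw [historyLaw, PMF.mem_support_pure_iff] at hx
    simp [hx]
  | succ n ih =>
    simp only [historyLaw, PMF.mem_support_bind_iff, PMF.mem_support_map_iff] at hx
    obtain ⟨y, hy, a, -, b, -, s', -, rfl⟩ := hx
    simp [ih y hy]

lemma stepMean_le_one {l : List (S × A × B)} {s : S} {f : A → B → S → ℝ}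
    (h : ∀ a b, (G.P s a b).mean (f a b) ≤ 1) : stepMean G nash D H δ T opp l s f ≤ 1 :=
  PMF.mean_le _ fun a => PMF.mean_le _ (h a)

/-- Deviation of weighted sums of `f(sₜ₊₁) - P f(sₜ, aₜ, bₜ)`. -/
lemma stepMean_exp_transition_le {R : ℝ} (f : S → ℝ) (hf : ∀ x y, f x ≤ f y + R)
    (w : List (S × A × B) → S → A → B → ℝ) (l : List (S × A × B)) (s : S) :
    stepMean G nash D H δ T opp l s (fun a b s' => Real.exp
      (w l s a b * (f s' - (G.P s a b).mean f) - w l s a b ^ 2 * R ^ 2 / 8)) ≤ 1 := by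
  refine stepMean_le_one G nash D H δ T opp fun a b => ?_
  simp only [sub_eq_add_neg _ (w l s a b ^ 2 * R ^ 2 / 8), Real.exp_add]
  simp only [mul_comm _ (Real.exp (-(w l s a b ^ 2 * R ^ 2 / 8)))]
  rw [PMF.mean_const_mul, Real.exp_neg, inv_mul_le_one₀ (Real.exp_pos _)]
  exact PMF.mean_exp_le _ f hf _

end DONQ

/-! ### Invariants of the update -/

namespace DONQ

variable {S A B : Type*}

/-- Visit count of a triple. -/
def count (e : DONQState S A B) (z : S × A × B) : ℕ := e.N z.1 z.2.1 z.2.2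

/-- Estimator `Q̄` of a triple. -/
def upperQ (e : DONQState S A B) (z : S × A × B) : ℝ := e.Q z.1 z.2.1 z.2.2

/-- Estimator `Q̄↓` of a triple. -/
def lowerQ (e : DONQState S A B) (z : S × A × B) : ℝ := e.Qd z.1 z.2.1 z.2.2

/-- The target `r + γ V̄↓(s') + β` of an update. -/
noncomputable def target (G : StochasticGame S A B) (D H δ : ℝ) (T : ℕ) (e : DONQState S A B)
    (z : S × A × B) (s' : S) : ℝ :=
  G.r z.1 z.2.1 z.2.2 + (1 - 1 / H) * e.V s' + bonus D H δ T (count e z + 1)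

lemma rate_nonneg {H : ℝ} (hH : 1 ≤ H) (n : ℕ) : 0 ≤ rate H n := by
  unfold rate; positivity

lemma one_sub_rate_succ {H : ℝ} (hH : 1 ≤ H) (n : ℕ) :
    1 - rate H (n + 1) = n / (H + (n + 1)) := by
  unfold rate
  push_cast
  have : (0 : ℝ) < H + (n + 1) := by positivity
  field_simp
  ring

lemma one_sub_rate_succ_nonneg {H : ℝ} (hH : 1 ≤ H) (n : ℕ) : 0 ≤ 1 - rate H (n + 1) := by
  rw [one_sub_rate_succ hH]; positivity

lemma bonus_nonneg {D : ℝ} (hD : 0 ≤ D) (H δ : ℝ) (T n : ℕ) : 0 ≤ bonus D H δ T n := by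
  unfold bonus; positivity

section Update

variable [Fintype S] [Fintype A] [Fintype B] [DecidableEq S] [DecidableEq A] [DecidableEq B]
  (G : StochasticGame S A B) (nash : (A → B → ℝ) → PMF A × PMF B) (D H δ : ℝ) (T : ℕ)
  (e : DONQState S A B) (s : S) (a : A) (b : B) (s' : S)

lemma count_update_self : count (update G nash D H δ T e s a b s') (s, a, b) =
    count e (s, a, b) + 1 := by
  simp [count, update]

lemma upperQ_update_self : upperQ (update G nash D H δ T e s a b s') (s, a, b) =
    (1 - rate H (count e (s, a, b) + 1)) * upperQ e (s, a, b) +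
      rate H (count e (s, a, b) + 1) * target G D H δ T e (s, a, b) s' := by
  simp [upperQ, update, count, target]

lemma lowerQ_update_self : lowerQ (update G nash D H δ T e s a b s') (s, a, b) =
    min (lowerQ e (s, a, b)) (upperQ (update G nash D H δ T e s a b s') (s, a, b)) := by
  simp [lowerQ, upperQ, update]

variable {s a b}

lemma apply_update_update_update_of_ne {γ : Type*} (f : S → A → B → γ) (c : γ) {z : S × A × B}
    (hz : z ≠ (s, a, b)) :
    Function.update f s (Function.update (f s) a (Function.update (f s a) b c)) z.1 z.2.1 z.2.2 =
      f z.1 z.2.1 z.2.2 := by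
  obtain ⟨x, y, w⟩ := z
  by_cases hx : x = s
  · subst hx
    by_cases hy : y = a
    · subst hy
      have hw : w ≠ b := fun h => hz (by rw [h])
      simp [hw]
    · simp [hy]
  · simp [hx]

lemma count_update_of_ne {z : S × A × B} (hz : z ≠ (s, a, b)) :
    count (update G nash D H δ T e s a b s') z = count e z :=
  apply_update_update_update_of_ne _ _ hz

lemma upperQ_update_of_ne {z : S × A × B} (hz : z ≠ (s, a, b)) :
    upperQ (update G nash D H δ T e s a b s') z = upperQ e z :=
  apply_update_update_update_of_ne _ _ hz

lemma lowerQ_update_of_ne {z : S × A × B} (hz : z ≠ (s, a, b)) :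
    lowerQ (update G nash D H δ T e s a b s') z = lowerQ e z :=
  apply_update_update_update_of_ne _ _ hz

lemma lowerQ_update_le (z : S × A × B) :
    lowerQ (update G nash D H δ T e s a b s') z ≤ lowerQ e z := by
  by_cases hz : z = (s, a, b)
  · subst hz
    rw [lowerQ_update_self]
    exact min_le_left _ _
  · rw [lowerQ_update_of_ne _ _ _ _ _ _ _ _ hz]

lemma update_of_ne {x : S} (hx : x ≠ s) : (update G nash D H δ T e s a b s').V x = e.V x ∧
    (update G nash D H δ T e s a b s').μ x = e.μ x ∧
    (update G nash D H δ T e s a b s').Qd x = e.Qd x := by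
  simp [update, hx]

lemma update_self : (update G nash D H δ T e s a b s').V s =
    matrixPayoff (nash ((update G nash D H δ T e s a b s').Qd s)).1
      (nash ((update G nash D H δ T e s a b s').Qd s)).2
      ((update G nash D H δ T e s a b s').Qd s) ∧
    (update G nash D H δ T e s a b s').μ s =
      (nash ((update G nash D H δ T e s a b s').Qd s)).1 := by
  simp [update]

end Update

/-- The properties of the estimators that hold whatever the plays. -/
structure Consistent [Fintype A] [Fintype B] (H : ℝ) (e : DONQState S A B) : Prop where
  upperQ_nonneg : ∀ z, 0 ≤ upperQ e z
  lowerQ_nonneg : ∀ z, 0 ≤ lowerQ e z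
  lowerQ_le : ∀ z, lowerQ e z ≤ H
  lowerQ_le_upperQ : ∀ z, lowerQ e z ≤ upperQ e z
  exists_nash : ∀ x, ∃ ν, IsMatrixNash (e.Qd x) (e.μ x) ν ∧
    matrixPayoff (e.μ x) ν (e.Qd x) = e.V x

namespace Consistent

variable [Fintype A] [Fintype B] {H : ℝ} {e : DONQState S A B}

lemma V_nonneg (he : Consistent H e) (x : S) : 0 ≤ e.V x := by
  obtain ⟨ν, -, h⟩ := he.exists_nash x
  rw [← h]
  exact le_matrixPayoff _ _ fun a b => he.lowerQ_nonneg (x, a, b)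

lemma V_le (he : Consistent H e) (x : S) : e.V x ≤ H := by
  obtain ⟨ν, -, h⟩ := he.exists_nash x
  rw [← h]
  exact matrixPayoff_le _ _ fun a b => he.lowerQ_le (x, a, b)

/-- Where the arbitrary opponent is handled: the learner's equilibrium strategy guarantees `V̄↓`
against any mixed action. -/
lemma V_le_payoff (he : Consistent H e) (x : S) (ν : PMF B) :
    e.V x ≤ matrixPayoff (e.μ x) ν (e.Qd x) := by
  obtain ⟨ν', hn, h⟩ := he.exists_nash x
  rw [← h]
  exact hn.2 ν

lemma V_mono {e' : DONQState S A B} {H' : ℝ} (he : Consistent H e) (he' : Consistent H' e')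
    (h : ∀ z, lowerQ e z ≤ lowerQ e' z) (x : S) : e.V x ≤ e'.V x := by
  obtain ⟨ν, hn, h1⟩ := he.exists_nash x
  obtain ⟨ν', hn', h1'⟩ := he'.exists_nash x
  rw [← h1, ← h1']
  exact hn.payoff_mono hn' fun a b => h (x, a, b)

end Consistent

lemma consistent_init [Fintype A] [Fintype B] [Nonempty A] [Nonempty B] {H : ℝ} (hH : 1 ≤ H) :
    Consistent H (init S A B H) where
  upperQ_nonneg _ := by simp only [upperQ, init]; linarith
  lowerQ_nonneg _ := by simp only [lowerQ, init]; linarith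
  lowerQ_le _ := le_rfl
  lowerQ_le_upperQ _ := le_rfl
  exists_nash x := by
    refine ⟨PMF.uniformOfFintype B, ⟨fun μ' => ?_, fun ν' => ?_⟩, ?_⟩ <;>
      simp [init, matrixPayoff_const]

lemma target_nonneg {G : StochasticGame S A B} {D H δ : ℝ} {T : ℕ} (hD : 0 ≤ D) (hH : 1 ≤ H)
    {e : DONQState S A B} {s' : S} (hV : 0 ≤ e.V s') (z : S × A × B) :
    0 ≤ target G D H δ T e z s' := by
  have h1 := G.r_nonneg z.1 z.2.1 z.2.2
  have h2 := bonus_nonneg hD H δ T (count e z + 1)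
  have h3 : 0 ≤ 1 - 1 / H := by
    rw [sub_nonneg, div_le_one (by linarith)]
    exact hH
  unfold target
  positivity

lemma Consistent.update [Fintype S] [Fintype A] [Fintype B] [DecidableEq S] [DecidableEq A]
    [DecidableEq B] {G : StochasticGame S A B} {nash : (A → B → ℝ) → PMF A × PMF B} {D H δ : ℝ}
    {T : ℕ} {e : DONQState S A B} (hnash : ∀ M, IsMatrixNash M (nash M).1 (nash M).2) (hD : 0 ≤ D)
    (hH : 1 ≤ H) (he : Consistent H e) (s : S) (a : A) (b : B) (s' : S) :
    Consistent H (update G nash D H δ T e s a b s') := by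
  have hQ (z : S × A × B) : 0 ≤ upperQ (DONQ.update G nash D H δ T e s a b s') z := by
    by_cases hz : z = (s, a, b)
    · subst hz
      rw [upperQ_update_self]
      exact add_nonneg (mul_nonneg (one_sub_rate_succ_nonneg hH _) (he.upperQ_nonneg _))
        (mul_nonneg (rate_nonneg hH _) (target_nonneg hD hH (he.V_nonneg _) _))
    · rw [upperQ_update_of_ne _ _ _ _ _ _ _ _ hz]
      exact he.upperQ_nonneg z
  refine ⟨hQ, fun z => ?_, fun z => (lowerQ_update_le _ _ _ _ _ _ _ _ z).trans (he.lowerQ_le z),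
    fun z => ?_, fun x => ?_⟩
  · by_cases hz : z = (s, a, b)
    · subst hz
      rw [lowerQ_update_self]
      exact le_min (he.lowerQ_nonneg _) (hQ _)
    · rw [lowerQ_update_of_ne _ _ _ _ _ _ _ _ hz]
      exact he.lowerQ_nonneg z
  · by_cases hz : z = (s, a, b)
    · subst hz
      rw [lowerQ_update_self]
      exact min_le_right _ _
    · rw [lowerQ_update_of_ne _ _ _ _ _ _ _ _ hz, upperQ_update_of_ne _ _ _ _ _ _ _ _ hz]
      exact he.lowerQ_le_upperQ z
  · by_cases hx : x = s
    · subst hx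
      obtain ⟨h1, h2⟩ := update_self G nash D H δ T e (s := x) (a := a) (b := b) s'
      rw [h1, h2]
      exact ⟨_, hnash _, rfl⟩
    · obtain ⟨h1, h2, h3⟩ := update_of_ne G nash D H δ T e (s := s) (a := a) (b := b) s' hx
      rw [h1, h2, h3]
      exact he.exists_nash x

/-- An infinite sequence of states and actions. -/
structure Path (S A B : Type*) where
  s : ℕ → S
  a : ℕ → A
  b : ℕ → B

/-! ### Histories as paths indexed by time -/

namespace Path

variable (p : Path S A B)

/-- The triple visited at time `t`. -/
def play (t : ℕ) : S × A × B := (p.s t, p.a t, p.b t)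

/-- The history before time `t`, most recent play first. -/
def hist : ℕ → List (S × A × B)
  | 0 => []
  | t + 1 => p.play t :: hist t

lemma pathSum_hist (inc : List (S × A × B) → S → A → B → S → ℝ) (n : ℕ) :
    pathSum inc (p.hist n) (p.s n) =
      ∑ t ∈ Finset.range n, inc (p.hist t) (p.s t) (p.a t) (p.b t) (p.s (t + 1)) := by
  induction n with
  | zero => rfl
  | succ n ih => rw [Finset.sum_range_succ, ← ih]; rfl

lemma regret_hist (G : StochasticGame S A B) (J : ℝ) (n : ℕ) :
    regret G J (p.hist n) =
      ∑ t ∈ Finset.range n, (J - G.r (p.s t) (p.a t) (p.b t)) := by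
  induction n with
  | zero => rfl
  | succ n ih =>
    rw [Finset.sum_range_succ, ← ih]
    simp [hist, regret, play, add_comm]

lemma hist_congr {p q : Path S A B} {n : ℕ} (h : ∀ t < n, p.play t = q.play t) :
    p.hist n = q.hist n := by
  induction n with
  | zero => rfl
  | succ n ih => rw [hist, hist, h n n.lt_succ_self, ih fun t ht => h t (ht.trans n.lt_succ_self)]

/-- Lets the deterministic estimates be written with sums over time; the path beyond the given
history is irrelevant. -/
lemma exists_hist_eq [Nonempty A] [Nonempty B] (l : List (S × A × B)) (x : S) :
    ∃ p : Path S A B, p.hist l.length = l ∧ p.s l.length = x := by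
  classical
  induction l generalizing x with
  | nil => exact ⟨⟨fun _ => x, fun _ => Classical.arbitrary A, fun _ => Classical.arbitrary B⟩,
      rfl, rfl⟩
  | cons z l ih =>
    obtain ⟨y, a, b⟩ := z
    obtain ⟨p, hp, hy⟩ := ih y
    refine ⟨⟨Function.update p.s (l.length + 1) x, Function.update p.a l.length a,
      Function.update p.b l.length b⟩, ?_, by simp⟩
    rw [List.length_cons, hist]
    congr 1
    · simp [play, hy]
    · conv_rhs => rw [← hp]
      refine hist_congr fun t ht => ?_
      simp [play, ht.ne, (ht.trans (Nat.lt_succ_self _)).ne]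

/-- Summation along a path of the changes of a potential which only changes at the current play. -/
lemma sum_potential_sub {Z : Type*} [Fintype Z] [DecidableEq Z] (z : ℕ → Z) (Ψ : ℕ → Z → ℝ)
    (h : ∀ t x, x ≠ z t → Ψ (t + 1) x = Ψ t x) (n : ℕ) :
    ∑ t ∈ Finset.range n, (Ψ (t + 1) (z t) - Ψ t (z t)) = ∑ x, Ψ n x - ∑ x, Ψ 0 x := by
  rw [← Finset.sum_range_sub (fun t => ∑ x, Ψ t x)]
  refine Finset.sum_congr rfl fun t _ => ?_
  rw [← Finset.sum_sub_distrib]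
  symm
  apply Finset.sum_eq_single_of_mem (z t) (Finset.mem_univ _)
  intro x _ hx
  rw [h t x hx, sub_self]

end Path

/-! ### The estimators along a path -/

section Run

variable [Fintype S] [Fintype A] [Fintype B] [DecidableEq S] [DecidableEq A] [DecidableEq B]
  [Nonempty A] (G : StochasticGame S A B) (nash : (A → B → ℝ) → PMF A × PMF B) (D H δ : ℝ)
  (T : ℕ) (p : Path S A B)

/-- The estimators of DONQ-learning at time `t` along a path. -/
noncomputable def run (t : ℕ) : DONQState S A B := estimate G nash D H δ T (p.hist t) (p.s t)

local notation "𝓔" => run G nash D H δ T p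

lemma count_run_zero (z : S × A × B) : count (𝓔 0) z = 0 := rfl

lemma count_run_play (t : ℕ) : count (𝓔 (t + 1)) (p.play t) = count (𝓔 t) (p.play t) + 1 :=
  count_update_self _ _ _ _ _ _ _ _ _ _ _

lemma count_run_of_ne {t : ℕ} {z : S × A × B} (hz : z ≠ p.play t) :
    count (𝓔 (t + 1)) z = count (𝓔 t) z :=
  count_update_of_ne _ _ _ _ _ _ _ _ hz

lemma upperQ_run_play (t : ℕ) : upperQ (𝓔 (t + 1)) (p.play t) =
    (1 - rate H (count (𝓔 t) (p.play t) + 1)) * upperQ (𝓔 t) (p.play t) +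
      rate H (count (𝓔 t) (p.play t) + 1) *
        target G D H δ T (𝓔 t) (p.play t) (p.s (t + 1)) :=
  upperQ_update_self _ _ _ _ _ _ _ _ _ _ _

lemma upperQ_run_of_ne {t : ℕ} {z : S × A × B} (hz : z ≠ p.play t) :
    upperQ (𝓔 (t + 1)) z = upperQ (𝓔 t) z :=
  upperQ_update_of_ne _ _ _ _ _ _ _ _ hz

lemma lowerQ_run_play (t : ℕ) : lowerQ (𝓔 (t + 1)) (p.play t) =
    min (lowerQ (𝓔 t) (p.play t)) (upperQ (𝓔 (t + 1)) (p.play t)) :=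
  lowerQ_update_self _ _ _ _ _ _ _ _ _ _ _

lemma lowerQ_run_of_ne {t : ℕ} {z : S × A × B} (hz : z ≠ p.play t) :
    lowerQ (𝓔 (t + 1)) z = lowerQ (𝓔 t) z :=
  lowerQ_update_of_ne _ _ _ _ _ _ _ _ hz

lemma count_run_le_succ (t : ℕ) (z : S × A × B) : count (𝓔 t) z ≤ count (𝓔 (t + 1)) z := by
  by_cases hz : z = p.play t
  · rw [hz, count_run_play]; exact Nat.le_succ _
  · rw [count_run_of_ne _ _ _ _ _ _ _ hz]

lemma count_run_mono (z : S × A × B) : Monotone fun t => count (𝓔 t) z :=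
  monotone_nat_of_le_succ fun t => count_run_le_succ _ _ _ _ _ _ _ t z

lemma count_run_le (t : ℕ) (z : S × A × B) : count (𝓔 t) z ≤ t := by
  induction t with
  | zero => rfl
  | succ t ih =>
    by_cases hz : z = p.play t
    · rw [hz, count_run_play, ← hz]; exact Nat.succ_le_succ ih
    · rw [count_run_of_ne _ _ _ _ _ _ _ hz]; exact ih.trans t.le_succ

variable {G nash D H δ T p}

lemma consistent_run [Nonempty B] (hnash : ∀ M, IsMatrixNash M (nash M).1 (nash M).2) (hD : 0 ≤ D)
    (hH : 1 ≤ H) (t : ℕ) : Consistent H (𝓔 t) := by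
  induction t with
  | zero => exact consistent_init hH
  | succ t ih => exact ih.update hnash hD hH _ _ _ _

/-- The purpose of the minimum defining `Q̄↓`: as matrix values are monotone, the estimates of the
value never increase, which `sum_shift_le` requires. -/
lemma V_run_succ_le [Nonempty B] (hnash : ∀ M, IsMatrixNash M (nash M).1 (nash M).2) (hD : 0 ≤ D)
    (hH : 1 ≤ H) (t : ℕ) (x : S) : (𝓔 (t + 1)).V x ≤ (𝓔 t).V x :=
  (consistent_run hnash hD hH (t + 1)).V_mono (consistent_run hnash hD hH t)
    (fun z => lowerQ_update_le _ _ _ _ _ _ _ _ z) x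

end Run

end DONQ

/-! ### Telescoping sums of the learning recursion -/

namespace DONQ

variable {S A B : Type*} [Fintype S] [Fintype A] [Fintype B]

/-- Shifting the state by one step in a sum of values decreasing in time. -/
lemma sum_shift_le (x : ℕ → S) (Φ : ℕ → S → ℝ) {K : ℝ} (n : ℕ)
    (hanti : ∀ t y, Φ (t + 1) y ≤ Φ t y) (h0 : ∀ y, Φ 0 y ≤ K) (hn : ∀ y, 0 ≤ Φ n y) :
    ∑ t ∈ Finset.range n, Φ t (x (t + 1)) ≤
      ∑ t ∈ Finset.range n, Φ t (x t) + (Fintype.card S + 1) * K := by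
  have hA (y : S) : Antitone fun t => Φ t y := antitone_nat_of_succ_le fun t => hanti t y
  -- The drop at the visited state is at most the total drop over all states, and each state can
  -- lose at most `K` over all times.
  have h1 : ∑ t ∈ Finset.range n, (Φ t (x (t + 1)) - Φ (t + 1) (x (t + 1))) ≤
      Fintype.card S * K := by
    calc _ ≤ ∑ t ∈ Finset.range n, ∑ y, (Φ t y - Φ (t + 1) y) :=
          Finset.sum_le_sum fun t _ => Finset.single_le_sum (f := fun y => Φ t y - Φ (t + 1) y)
            (fun y _ => sub_nonneg.2 (hanti t y)) (Finset.mem_univ _)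
      _ = ∑ y, (Φ 0 y - Φ n y) := by
          rw [Finset.sum_comm]
          exact Finset.sum_congr rfl fun y _ => Finset.sum_range_sub' (fun t => Φ t y) n
      _ ≤ ∑ _y : S, K := Finset.sum_le_sum fun y _ => by linarith [h0 y, hn y]
      _ = Fintype.card S * K := by simp
  have h2 := Finset.sum_range_sub (fun t => Φ t (x t)) n
  rw [Finset.sum_sub_distrib] at h1 h2
  have h3 : Φ n (x n) ≤ K := (hA _ n.zero_le).trans (h0 _)
  have h4 : 0 ≤ Φ 0 (x 0) := (hn _).trans (hA _ n.zero_le)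
  linarith

/-- Weights that turn the learning recursion into a telescoping sum. -/
lemma learning_identity {H : ℝ} (hH : 1 ≤ H) (n : ℕ) (q x : ℝ) :
    (H + (n + 1 : ℕ)) / H * ((1 - rate H (n + 1)) * q + rate H (n + 1) * x) - (H + n) / H * q =
      (1 + 1 / H) * x - q := by
  rw [one_sub_rate_succ hH, rate]
  have : (0 : ℝ) < H + (n + 1) := by positivity
  have : 0 < H := by linarith
  push_cast
  field_simp
  ring

variable [DecidableEq S] [DecidableEq A] [DecidableEq B] [Nonempty A] [Nonempty B]
  {G : StochasticGame S A B} {nash : (A → B → ℝ) → PMF A × PMF B} {D H δ : ℝ} {T : ℕ}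
  {p : Path S A B}

local notation "𝓔" => run G nash D H δ T p

/-- The potential is `(H + n)/H · (Q̄ - C)`, with `n` the visit count of the triple. Its weight is
`1` at `n = 0`, so the initial term is `H - C`. -/
lemma sum_upperQ_sub (hH : 1 ≤ H) (C : S × A × B → ℝ) (n : ℕ) :
    ∑ t ∈ Finset.range n, (upperQ (𝓔 t) (p.play t) - C (p.play t)) =
      (1 + 1 / H) * ∑ t ∈ Finset.range n,
        (target G D H δ T (𝓔 t) (p.play t) (p.s (t + 1)) - C (p.play t)) +
      ∑ z, (H - C z) - ∑ z, (H + count (𝓔 n) z) / H * (upperQ (𝓔 n) z - C z) := by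
  have h := Path.sum_potential_sub p.play
    (fun t z => (H + count (𝓔 t) z) / H * (upperQ (𝓔 t) z - C z)) (fun t z hz => by
      rw [count_run_of_ne _ _ _ _ _ _ _ hz, upperQ_run_of_ne _ _ _ _ _ _ _ hz]) n
  have h0 : ∑ z, (H + count (𝓔 0) z) / H * (upperQ (𝓔 0) z - C z) = ∑ z, (H - C z) := by
    refine Finset.sum_congr rfl fun z _ => ?_
    rw [count_run_zero, Nat.cast_zero, add_zero, div_self (by linarith), one_mul]
    rfl
  rw [h0] at h
  have h1 (t : ℕ) : (H + count (𝓔 (t + 1)) (p.play t)) / H *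
      (upperQ (𝓔 (t + 1)) (p.play t) - C (p.play t)) -
      (H + count (𝓔 t) (p.play t)) / H * (upperQ (𝓔 t) (p.play t) - C (p.play t)) =
      (1 + 1 / H) * (target G D H δ T (𝓔 t) (p.play t) (p.s (t + 1)) - C (p.play t)) -
        (upperQ (𝓔 t) (p.play t) - C (p.play t)) := by
    rw [count_run_play, upperQ_run_play, ← learning_identity hH]
    ring
  simp only [h1] at h
  rw [Finset.sum_sub_distrib, ← Finset.mul_sum] at h
  linarith

/-- Same potential with squares: convexity of the square turns the recursion into an inequality in
the required direction. -/
lemma sum_upperQ_sq_le (hH : 1 ≤ H) (n : ℕ) :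
    ∑ t ∈ Finset.range n, upperQ (𝓔 t) (p.play t) ^ 2 ≤
      (1 + 1 / H) * ∑ t ∈ Finset.range n,
        target G D H δ T (𝓔 t) (p.play t) (p.s (t + 1)) ^ 2 +
      Fintype.card (S × A × B) * H ^ 2 := by
  have hH0 : 0 < H := by linarith
  have h := Path.sum_potential_sub p.play
    (fun t z => (H + count (𝓔 t) z) / H * upperQ (𝓔 t) z ^ 2) (fun t z hz => by
      rw [count_run_of_ne _ _ _ _ _ _ _ hz, upperQ_run_of_ne _ _ _ _ _ _ _ hz]) n
  have h0 : ∑ z, (H + count (𝓔 0) z) / H * upperQ (𝓔 0) z ^ 2 =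
      Fintype.card (S × A × B) * H ^ 2 := by
    have (z : S × A × B) : (H + count (𝓔 0) z) / H * upperQ (𝓔 0) z ^ 2 = H ^ 2 := by
      rw [count_run_zero, Nat.cast_zero, add_zero, div_self hH0.ne', one_mul]
      rfl
    simp only [this, Finset.sum_const, Finset.card_univ, nsmul_eq_mul]
  rw [h0] at h
  have hn : 0 ≤ ∑ z, (H + count (𝓔 n) z) / H * upperQ (𝓔 n) z ^ 2 :=
    Finset.sum_nonneg fun z _ => by positivity
  have h1 (t : ℕ) : (H + count (𝓔 (t + 1)) (p.play t)) / H * upperQ (𝓔 (t + 1)) (p.play t) ^ 2 -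
      (H + count (𝓔 t) (p.play t)) / H * upperQ (𝓔 t) (p.play t) ^ 2 ≤
      (1 + 1 / H) * target G D H δ T (𝓔 t) (p.play t) (p.s (t + 1)) ^ 2 -
        upperQ (𝓔 t) (p.play t) ^ 2 := by
    rw [count_run_play, upperQ_run_play, ← learning_identity hH (count (𝓔 t) (p.play t))]
    gcongr
    set α := rate H (count (𝓔 t) (p.play t) + 1)
    have e1 : 0 ≤ 1 - α := one_sub_rate_succ_nonneg hH _
    have e2 : 0 ≤ α := rate_nonneg hH _
    set q := upperQ (𝓔 t) (p.play t)
    set x := target G D H δ T (𝓔 t) (p.play t) (p.s (t + 1))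
    nlinarith [mul_nonneg (mul_nonneg e1 e2) (sq_nonneg (q - x))]
  have h2 := Finset.sum_le_sum fun t (_ : t ∈ Finset.range n) => h1 t
  rw [h, Finset.sum_sub_distrib, ← Finset.mul_sum] at h2
  linarith

/-- Bound on the sum of the bonuses. -/
noncomputable def bonusSum (k : ℕ) (D H δ : ℝ) (T : ℕ) : ℝ :=
  k * (4 * D * (Real.sqrt (H * Real.log (2 * T / δ)) * Real.sqrt T))

lemma bonus_succ_le (hD : 0 ≤ D) (hL : 0 ≤ H * Real.log (2 * T / δ)) (n : ℕ) :
    bonus D H δ T (n + 1) ≤ 4 * D * Real.sqrt (H * Real.log (2 * T / δ)) *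
      (Real.sqrt (n + 1 : ℕ) - Real.sqrt n) := by
  have hs : 0 < Real.sqrt (n + 1 : ℕ) := Real.sqrt_pos.2 (by positivity)
  have h1 : Real.sqrt (n + 1 : ℕ) ^ 2 = n + 1 := by
    rw [Real.sq_sqrt (by positivity)]; push_cast; ring
  have h2 : Real.sqrt n ^ 2 = n := Real.sq_sqrt (by positivity)
  have key : 1 / Real.sqrt (n + 1 : ℕ) ≤ 2 * (Real.sqrt (n + 1 : ℕ) - Real.sqrt n) := by
    rw [div_le_iff₀ hs]
    nlinarith [sq_nonneg (Real.sqrt (n + 1 : ℕ) - Real.sqrt n)]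
  rw [bonus, Real.sqrt_div hL]
  calc 2 * D * (Real.sqrt (H * Real.log (2 * T / δ)) / Real.sqrt (n + 1 : ℕ))
      = 2 * D * Real.sqrt (H * Real.log (2 * T / δ)) * (1 / Real.sqrt (n + 1 : ℕ)) := by ring
    _ ≤ 2 * D * Real.sqrt (H * Real.log (2 * T / δ)) *
        (2 * (Real.sqrt (n + 1 : ℕ) - Real.sqrt n)) := by gcongr
    _ = _ := by ring

/-- With potential `√n`, the bonuses telescope through `1/√(n+1) ≤ 2 (√(n+1) - √n)`; each final
count is at most `T`. -/
lemma sum_bonus_le (hD : 0 ≤ D) (hL : 0 ≤ H * Real.log (2 * T / δ)) :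
    ∑ t ∈ Finset.range T, bonus D H δ T (count (𝓔 t) (p.play t) + 1) ≤
      bonusSum (Fintype.card (S × A × B)) D H δ T := by
  have h := Path.sum_potential_sub p.play (fun t z => Real.sqrt (count (𝓔 t) z)) (fun t z hz => by
      rw [count_run_of_ne _ _ _ _ _ _ _ hz]) T
  simp only [count_run_zero, Nat.cast_zero, Real.sqrt_zero, Finset.sum_const_zero, sub_zero,
    count_run_play] at h
  have h1 : ∑ z, Real.sqrt (count (𝓔 T) z) ≤ Fintype.card (S × A × B) * Real.sqrt T := by
    calc _ ≤ ∑ _z : S × A × B, Real.sqrt T := Finset.sum_le_sum fun z _ =>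
          Real.sqrt_le_sqrt (by exact_mod_cast count_run_le _ _ _ _ _ _ _ T z)
      _ = _ := by simp only [Finset.sum_const, Finset.card_univ, nsmul_eq_mul]
  calc _ ≤ ∑ t ∈ Finset.range T, 4 * D * Real.sqrt (H * Real.log (2 * T / δ)) *
        (Real.sqrt (count (𝓔 t) (p.play t) + 1 : ℕ) - Real.sqrt (count (𝓔 t) (p.play t))) :=
        Finset.sum_le_sum fun t _ => bonus_succ_le hD hL _
    _ = 4 * D * Real.sqrt (H * Real.log (2 * T / δ)) * ∑ z, Real.sqrt (count (𝓔 T) z) := by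
        rw [← Finset.mul_sum, h]
    _ ≤ 4 * D * Real.sqrt (H * Real.log (2 * T / δ)) *
        (Fintype.card (S × A × B) * Real.sqrt T) := by gcongr
    _ = _ := by rw [bonusSum]; ring

lemma bonus_le_bonus_of_le {m n : ℕ} (hD : 0 ≤ D) (hL : 0 ≤ H * Real.log (2 * T / δ)) (hm : 1 ≤ m)
    (hmn : m ≤ n) : bonus D H δ T n ≤ bonus D H δ T m := by
  have : (1 : ℝ) ≤ m := by exact_mod_cast hm
  have : (m : ℝ) ≤ n := by exact_mod_cast hmn
  unfold bonus
  gcongr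

/-- Bound on `∑ₜ (Q̄↓ₜ(sₜ, aₜ, bₜ)² - V̄↓ₜ(sₜ)²)`. -/
noncomputable def squareSum (k j : ℕ) (D H δ : ℝ) (T : ℕ) : ℝ :=
  (k + j + 1) * H ^ 2 + 4 * H * (T + bonusSum k D H δ T) +
    4 * (T + bonus D H δ T 1 * bonusSum k D H δ T)

/-- The squares of `Q̄` are bounded by squared targets, hence by squares of `V̄↓` at the next
states, then at the current ones. The terms of order `H² T` cancel; what is left is the cross term
between value and reward plus bonus, of order `H` per step apart from the bonuses. -/
lemma sum_lowerQ_sq_sub_le (hnash : ∀ M, IsMatrixNash M (nash M).1 (nash M).2) (hD : 0 ≤ D)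
    (hH : 1 ≤ H) (hL : 0 ≤ H * Real.log (2 * T / δ)) :
    ∑ t ∈ Finset.range T, (lowerQ (𝓔 t) (p.play t) ^ 2 - (𝓔 t).V (p.s t) ^ 2) ≤
      squareSum (Fintype.card (S × A × B)) (Fintype.card S) D H δ T := by
  have hH0 : 0 < H := by linarith
  have he := fun t => consistent_run (G := G) (δ := δ) (T := T) (p := p) hnash hD hH t
  have h1 : ∑ t ∈ Finset.range T, lowerQ (𝓔 t) (p.play t) ^ 2 ≤
      ∑ t ∈ Finset.range T, upperQ (𝓔 t) (p.play t) ^ 2 :=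
    Finset.sum_le_sum fun t _ =>
      pow_le_pow_left₀ ((he t).lowerQ_nonneg _) ((he t).lowerQ_le_upperQ _) 2
  have h2 := sum_upperQ_sq_le (G := G) (nash := nash) (D := D) (δ := δ) (T := T) (p := p) hH T
  have h3 := sum_shift_le p.s (fun t x => (𝓔 t).V x ^ 2) (K := H ^ 2) T
    (fun t x => pow_le_pow_left₀ ((he _).V_nonneg _) (V_run_succ_le hnash hD hH t x) 2)
    (fun x => pow_le_pow_left₀ ((he _).V_nonneg _) ((he _).V_le _) 2) (fun x => sq_nonneg _)
  have h4 (t : ℕ) : (1 + 1 / H) * target G D H δ T (𝓔 t) (p.play t) (p.s (t + 1)) ^ 2 ≤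
      (𝓔 t).V (p.s (t + 1)) ^ 2 + (4 * H * (1 + bonus D H δ T (count (𝓔 t) (p.play t) + 1)) +
        4 * (1 + bonus D H δ T 1 * bonus D H δ T (count (𝓔 t) (p.play t) + 1))) := by
    have hr := G.r_nonneg (p.play t).1 (p.play t).2.1 (p.play t).2.2
    have hr1 := G.r_le_one (p.play t).1 (p.play t).2.1 (p.play t).2.2
    have hv := (he t).V_nonneg (p.s (t + 1))
    have hv1 := (he t).V_le (p.s (t + 1))
    have hβ := bonus_nonneg hD H δ T (count (𝓔 t) (p.play t) + 1)
    have hβ1 := bonus_le_bonus_of_le (D := D) (H := H) (δ := δ) (T := T) hD hL le_rfl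
      (Nat.le_add_left 1 (count (𝓔 t) (p.play t)))
    rw [target]
    set r := G.r (p.play t).1 (p.play t).2.1 (p.play t).2.2
    set v := (𝓔 t).V (p.s (t + 1))
    set β := bonus D H δ T (count (𝓔 t) (p.play t) + 1)
    set β₁ := bonus D H δ T 1
    set u := 1 / H with hu
    have hu0 : 0 ≤ u := by positivity
    have hu1 : u ≤ 1 := by rw [hu, div_le_one hH0]; exact hH
    -- Discounting compensates the factor `1 + 1/H` of the learning rate, so `V̄↓²` appears with
    -- coefficient at most `1`.
    have e1 : (1 + u) * (1 - u) ^ 2 ≤ 1 := by nlinarith [mul_nonneg hu0 hu0]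
    have e2 : (1 - u) * v * (r + β) ≤ H * (1 + β) := by
      apply mul_le_mul _ (by linarith) (by positivity) hH0.le
      nlinarith
    have e3 : (r + β) ^ 2 ≤ 2 * (1 + β₁ * β) := by nlinarith [sq_nonneg (r - β)]
    have e4 : 0 ≤ H * (1 + β) := by positivity
    calc (1 + u) * (r + (1 - u) * v + β) ^ 2
        = (1 + u) * (1 - u) ^ 2 * v ^ 2 + (1 + u) * (2 * ((1 - u) * v * (r + β)) + (r + β) ^ 2) := by
          ring
      _ ≤ 1 * v ^ 2 + 2 * (2 * (H * (1 + β)) + 2 * (1 + β₁ * β)) := by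
          gcongr
          linarith
      _ = _ := by ring
  have h5 := Finset.sum_le_sum fun t (_ : t ∈ Finset.range T) => h4 t
  rw [← Finset.mul_sum, Finset.sum_add_distrib, Finset.sum_add_distrib, ← Finset.mul_sum,
    ← Finset.mul_sum, Finset.sum_add_distrib, Finset.sum_add_distrib, ← Finset.mul_sum] at h5
  simp only [Finset.sum_const, Finset.card_range, nsmul_eq_mul, mul_one] at h5
  have h6 := sum_bonus_le (G := G) (nash := nash) (p := p) hD hL
  set sB := ∑ t ∈ Finset.range T, bonus D H δ T (count (𝓔 t) (p.play t) + 1)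
  have h7 : 4 * H * sB ≤ 4 * H * bonusSum (Fintype.card (S × A × B)) D H δ T := by gcongr
  have h8 : bonus D H δ T 1 * sB ≤
      bonus D H δ T 1 * bonusSum (Fintype.card (S × A × B)) D H δ T :=
    mul_le_mul_of_nonneg_left h6 (bonus_nonneg hD H δ T 1)
  rw [Finset.sum_sub_distrib, squareSum]
  linarith

end DONQ

/-! ### Learning weights, optimism and regret along a path -/

namespace DONQ

/-- The weight of the `i`-th target in the estimator after `n` visits. -/
noncomputable def visitWeight (H : ℝ) : ℕ → ℕ → ℝ
  | 0, _ => 0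
  | n + 1, i => if i = n + 1 then rate H (n + 1) else (1 - rate H (n + 1)) * visitWeight H n i

lemma visitWeight_of_lt (H : ℝ) {n i : ℕ} (h : n < i) : visitWeight H n i = 0 := by
  induction n with
  | zero => rfl
  | succ n ih => rw [visitWeight, if_neg (by omega), ih (by omega), mul_zero]

lemma visitWeight_succ_of_le (H : ℝ) {n i : ℕ} (h : i ≤ n) :
    visitWeight H (n + 1) i = (1 - rate H (n + 1)) * visitWeight H n i := by
  rw [visitWeight, if_neg (by omega)]

lemma visitWeight_succ_self (H : ℝ) (n : ℕ) : visitWeight H (n + 1) (n + 1) = rate H (n + 1) := by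
  rw [visitWeight, if_pos rfl]

/-- Variance proxy of the noise in an estimator. A new visit multiplies the old sum by `(1 - α)²`
and adds `α²`. -/
lemma sum_visitWeight_succ_sq_le {H : ℝ} (hH : 1 ≤ H) (n : ℕ) :
    ∑ i ∈ Finset.range (n + 1), visitWeight H (n + 1) (i + 1) ^ 2 ≤ 2 * H / (n + 1 : ℕ) := by
  induction n with
  | zero =>
    have : rate H 1 = 1 := by
      rw [rate, Nat.cast_one]
      exact div_self (by positivity)
    simp [visitWeight_succ_self, this]
    linarith
  | succ n ih =>
    rw [Finset.sum_range_succ, visitWeight_succ_self]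
    have h1 : ∑ i ∈ Finset.range (n + 1), visitWeight H (n + 1 + 1) (i + 1) ^ 2 =
        (1 - rate H (n + 1 + 1)) ^ 2 *
          ∑ i ∈ Finset.range (n + 1), visitWeight H (n + 1) (i + 1) ^ 2 := by
      rw [Finset.mul_sum]
      refine Finset.sum_congr rfl fun i hi => ?_
      rw [visitWeight_succ_of_le _ (by simpa using hi), mul_pow]
    rw [h1]
    refine (add_le_add_left (mul_le_mul_of_nonneg_left ih (sq_nonneg _)) _).trans ?_
    rw [one_sub_rate_succ hH, rate]
    push_cast
    have hn : (0 : ℝ) ≤ n := by positivity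
    set m : ℝ := n + 1 with hm
    have hm1 : 1 ≤ m := by linarith
    have e : (m / (H + (m + 1))) ^ 2 * (2 * H / m) + ((H + 1) / (H + (m + 1))) ^ 2 =
        (2 * H * m + (H + 1) ^ 2) / (H + (m + 1)) ^ 2 := by
      field_simp
    rw [e, div_le_div_iff₀ (by positivity) (by positivity)]
    nlinarith [mul_nonneg (by linarith : 0 ≤ H - 1) (by linarith : 0 ≤ m),
      mul_nonneg (mul_nonneg (by linarith : 0 ≤ H - 1) (by linarith : 0 ≤ H)) (by linarith : 0 ≤ m),
      mul_nonneg (mul_nonneg (by linarith : 0 ≤ H - 1) (by linarith : 0 ≤ H)) (by linarith : 0 ≤ H)]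

lemma sum_visitWeight_sq_le {H : ℝ} (hH : 1 ≤ H) {n : ℕ} (hn : 1 ≤ n) (m : ℕ) :
    ∑ i ∈ Finset.range m, visitWeight H n (i + 1) ^ 2 ≤ 2 * H / n := by
  obtain ⟨n, rfl⟩ := Nat.exists_eq_add_of_le' hn
  refine le_trans ?_ (sum_visitWeight_succ_sq_le hH n)
  calc _ ≤ ∑ i ∈ Finset.range (max m (n + 1)), visitWeight H (n + 1) (i + 1) ^ 2 :=
        Finset.sum_le_sum_of_subset_of_nonneg (by simp) fun _ _ _ => sq_nonneg _
    _ = _ := by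
        refine (Finset.sum_subset (by simp) fun i _ hi => ?_).symm
        rw [visitWeight_of_lt _ (by simp at hi; omega)]
        simp

variable {S A B : Type*} [Fintype S] [Fintype A] [Fintype B]
  [DecidableEq S] [DecidableEq A] [DecidableEq B] [Nonempty A] [Nonempty B]
  {G : StochasticGame S A B} {nash : (A → B → ℝ) → PMF A × PMF B} {D H δ : ℝ} {T : ℕ}
  {p : Path S A B}

local notation "𝓔" => run G nash D H δ T p

/-- The transition noise `f(sₜ₊₁) - P f(sₜ, aₜ, bₜ)`. -/
noncomputable def noise (G : StochasticGame S A B) (p : Path S A B) (f : S → ℝ) (t : ℕ) : ℝ :=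
  f (p.s (t + 1)) - (G.P (p.s t) (p.a t) (p.b t)).mean f

variable (G nash D H δ T p) in
/-- The noise in the estimator of `z` after `n` visits, accumulated before time `t`. -/
noncomputable def visitNoise (f : S → ℝ) (z : S × A × B) (n t : ℕ) : ℝ :=
  ∑ u ∈ Finset.range t,
    if p.play u = z then visitWeight H n (count (𝓔 u) z + 1) * noise G p f u else 0

lemma visitNoise_succ_of_ne (f : S → ℝ) {z : S × A × B} (n : ℕ) {t : ℕ} (h : p.play t ≠ z) :
    visitNoise G nash D H δ T p f z n (t + 1) = visitNoise G nash D H δ T p f z n t := by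
  rw [visitNoise, Finset.sum_range_succ, if_neg h, add_zero, visitNoise]

lemma visitNoise_succ_self (f : S → ℝ) (t : ℕ) :
    visitNoise G nash D H δ T p f (p.play t) (count (𝓔 t) (p.play t) + 1) (t + 1) =
      (1 - rate H (count (𝓔 t) (p.play t) + 1)) *
        visitNoise G nash D H δ T p f (p.play t) (count (𝓔 t) (p.play t)) t +
      rate H (count (𝓔 t) (p.play t) + 1) * noise G p f t := by
  rw [visitNoise, Finset.sum_range_succ, if_pos rfl, visitWeight_succ_self, visitNoise,
    Finset.mul_sum]
  congr 1
  refine Finset.sum_congr rfl fun u hu => ?_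
  split_ifs with h
  · have hle : count (𝓔 u) (p.play t) + 1 ≤ count (𝓔 t) (p.play t) := by
      rw [← h, ← count_run_play]
      exact count_run_mono _ _ _ _ _ _ _ _ (Finset.mem_range.1 hu)
    rw [visitWeight_succ_of_le _ hle, mul_assoc]
  · rw [mul_zero]

/-- With the visit number frozen, later visits have weight zero. The noise at time `t` is therefore
a sum up to the horizon, and a union bound over triples and visit numbers suffices. -/
lemma visitNoise_eq_of_le (f : S → ℝ) (z : S × A × B) {t n : ℕ} (h : t ≤ n) :
    visitNoise G nash D H δ T p f z (count (𝓔 t) z) n =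
      visitNoise G nash D H δ T p f z (count (𝓔 t) z) t := by
  symm
  refine Finset.sum_subset (by simpa using h) fun u _ hu => ?_
  split_ifs
  · rw [visitWeight_of_lt, zero_mul]
    exact Nat.lt_succ_of_le (count_run_mono _ _ _ _ _ _ _ z (by simpa using hu))
  · rfl

/-- The visits to `z` before time `t` carry the indices `1, …, count`, each exactly once. -/
lemma sum_visitWeight_count_sq_le (hH : 1 ≤ H) (z : S × A × B) {n : ℕ} (hn : 1 ≤ n) (t : ℕ) :
    ∑ u ∈ Finset.range t, (if p.play u = z then visitWeight H n (count (𝓔 u) z + 1) else 0) ^ 2 ≤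
      2 * H / n := by
  refine le_trans (le_of_eq ?_) (sum_visitWeight_sq_le hH hn (count (𝓔 t) z))
  induction t with
  | zero => rw [count_run_zero]; simp
  | succ t ih =>
    rw [Finset.sum_range_succ, ih]
    by_cases h : p.play t = z
    · subst h
      rw [if_pos rfl, count_run_play, Finset.sum_range_succ]
    · rw [if_neg h, count_run_of_ne _ _ _ _ _ _ _ (Ne.symm h)]
      simp

variable {W : S → ℝ} {μ : S → PMF A} {ν : S → PMF B}

/-- The optimal action values, on triples. -/
noncomputable def optQ (G : StochasticGame S A B) (H : ℝ) (W : S → ℝ) (z : S × A × B) : ℝ :=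
  G.qValue (1 - 1 / H) W z.1 z.2.1 z.2.2

lemma target_sub_optQ (t : ℕ) :
    target G D H δ T (𝓔 t) (p.play t) (p.s (t + 1)) - optQ G H W (p.play t) =
      (1 - 1 / H) * ((𝓔 t).V (p.s (t + 1)) - W (p.s (t + 1))) + (1 - 1 / H) * noise G p W t +
        bonus D H δ T (count (𝓔 t) (p.play t) + 1) := by
  simp only [target, optQ, StochasticGame.qValue, noise, Path.play]
  ring

lemma discount_mem {H : ℝ} (hH : 1 ≤ H) : 0 ≤ 1 - 1 / H ∧ 1 - 1 / H < 1 := by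
  have : 0 < H := by linarith
  exact ⟨by rw [sub_nonneg, div_le_one this]; exact hH, by linarith [one_div_pos.2 this]⟩

lemma value_le (hH : 1 ≤ H) (hW : G.IsDiscountedValue (1 - 1 / H) W μ ν) (x : S) : W x ≤ H := by
  have h := hW.one_sub_mul_le_one (discount_mem hH).1 (discount_mem hH).2 x
  rw [sub_sub_cancel, one_div, inv_mul_le_one₀ (by linarith)] at h
  exact h

lemma optQ_le (hH : 1 ≤ H) (hW : G.IsDiscountedValue (1 - 1 / H) W μ ν) (z : S × A × B) :
    optQ G H W z ≤ H := by
  have h1 := G.r_le_one z.1 z.2.1 z.2.2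
  have h2 := mul_le_mul_of_nonneg_left (PMF.mean_le (G.P z.1 z.2.1 z.2.2) (value_le hH hW))
    (discount_mem hH).1
  have h3 : (1 - 1 / H) * H = H - 1 := by
    have : H ≠ 0 := by linarith
    field_simp
  rw [optQ, StochasticGame.qValue]
  linarith

lemma optQ_nonneg (hH : 1 ≤ H) (hW : G.IsDiscountedValue (1 - 1 / H) W μ ν) (z : S × A × B) :
    0 ≤ optQ G H W z :=
  add_nonneg (G.r_nonneg _ _ _) (mul_nonneg (discount_mem hH).1
    (PMF.le_mean _ (hW.nonneg (discount_mem hH).1 (discount_mem hH).2)))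

/-- If the noise is dominated by the bonuses, then the estimators are optimistic. -/
lemma optimism (hnash : ∀ M, IsMatrixNash M (nash M).1 (nash M).2) (hD : 0 ≤ D) (hH : 1 ≤ H)
    (hL : 0 ≤ H * Real.log (2 * T / δ)) (hW : G.IsDiscountedValue (1 - 1 / H) W μ ν)
    (hnoise : ∀ t ≤ T, ∀ z, 1 ≤ count (𝓔 t) z →
      -bonus D H δ T (count (𝓔 t) z) ≤ visitNoise G nash D H δ T p W z (count (𝓔 t) z) t)
    (t : ℕ) (ht : t ≤ T) :
    (∀ z, optQ G H W z ≤ upperQ (𝓔 t) z) ∧ ∀ x, W x ≤ (𝓔 t).V x := by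
  obtain ⟨hγ0, hγ1⟩ := discount_mem hH
  set γ := 1 - 1 / H with hγ
  have of_strong (t : ℕ) (ht : t ≤ T) (z : S × A × B) (hz : 1 ≤ count (𝓔 t) z)
      (h : optQ G H W z + γ * visitNoise G nash D H δ T p W z (count (𝓔 t) z) t +
        bonus D H δ T (count (𝓔 t) z) ≤ upperQ (𝓔 t) z) : optQ G H W z ≤ upperQ (𝓔 t) z := by
    have h1 := hnoise t ht z hz
    have h2 := bonus_nonneg hD H δ T (count (𝓔 t) z)
    nlinarith
  -- The induction needs a statement that keeps the noise and a full bonus explicit, since optimism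
  -- alone does not pass through the recursion.
  suffices h : (∀ z, (count (𝓔 t) z = 0 ∧ upperQ (𝓔 t) z = H) ∨ (1 ≤ count (𝓔 t) z ∧
      optQ G H W z + γ * visitNoise G nash D H δ T p W z (count (𝓔 t) z) t +
        bonus D H δ T (count (𝓔 t) z) ≤ upperQ (𝓔 t) z)) ∧ (∀ z, optQ G H W z ≤ lowerQ (𝓔 t) z) ∧
      ∀ x, W x ≤ (𝓔 t).V x by
    exact ⟨fun z => (h.2.1 z).trans ((consistent_run hnash hD hH t).lowerQ_le_upperQ z), h.2.2⟩
  induction t with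
  | zero =>
    exact ⟨fun z => Or.inl ⟨rfl, rfl⟩, fun z => optQ_le hH hW z, fun x => value_le hH hW x⟩
  | succ t ih =>
    obtain ⟨h1, h2, h3⟩ := ih (by omega)
    have h1' : ∀ z, (count (𝓔 (t + 1)) z = 0 ∧ upperQ (𝓔 (t + 1)) z = H) ∨
        (1 ≤ count (𝓔 (t + 1)) z ∧ optQ G H W z +
          γ * visitNoise G nash D H δ T p W z (count (𝓔 (t + 1)) z) (t + 1) +
          bonus D H δ T (count (𝓔 (t + 1)) z) ≤ upperQ (𝓔 (t + 1)) z) := by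
      intro z
      by_cases hz : z = p.play t
      · subst hz
        right
        rw [count_run_play, visitNoise_succ_self, upperQ_run_play]
        refine ⟨Nat.le_add_left _ _, ?_⟩
        have e1 := target_sub_optQ (G := G) (nash := nash) (D := D) (H := H) (δ := δ) (T := T)
          (p := p) (W := W) t
        have e2 := mul_nonneg hγ0 (sub_nonneg.2 (h3 (p.s (t + 1))))
        have e3 := rate_nonneg hH (count (𝓔 t) (p.play t) + 1)
        have e4 := one_sub_rate_succ_nonneg hH (count (𝓔 t) (p.play t))
        rcases h1 (p.play t) with ⟨hc, -⟩ | ⟨hc, hq⟩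
        -- At the first visit the rate is `1`: the initial value `H` is forgotten entirely.
        · have e5 : 1 - rate H (count (𝓔 t) (p.play t) + 1) = 0 := by
            rw [hc, one_sub_rate_succ hH]; simp
          have e6 : rate H (count (𝓔 t) (p.play t) + 1) = 1 := by linarith
          rw [e5, e6]
          linarith
        -- Bonuses decrease with the visit number, so the average of old and new bonuses is at least
        -- the new one.
        · have e5 := bonus_le_bonus_of_le (D := D) (H := H) (δ := δ) (T := T) hD hL hc
            (Nat.le_succ _)
          rw [Nat.succ_eq_add_one] at e5
          set α := rate H (count (𝓔 t) (p.play t) + 1)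
          set x := target G D H δ T (𝓔 t) (p.play t) (p.s (t + 1))
          have e6 := mul_le_mul_of_nonneg_left hq e4
          have e7 := mul_le_mul_of_nonneg_left e5 e4
          have e8 : optQ G H W (p.play t) + γ * noise G p W t +
            bonus D H δ T (count (𝓔 t) (p.play t) + 1) ≤ x := by linarith
          have e9 := mul_le_mul_of_nonneg_left e8 e3
          linarith
      · rw [count_run_of_ne _ _ _ _ _ _ _ hz, upperQ_run_of_ne _ _ _ _ _ _ _ hz,
          visitNoise_succ_of_ne _ _ (Ne.symm hz)]
        exact h1 z
    have hup (z : S × A × B) : optQ G H W z ≤ upperQ (𝓔 (t + 1)) z := by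
      rcases h1' z with ⟨-, hq⟩ | ⟨hc, hq⟩
      · rw [hq]; exact optQ_le hH hW z
      · exact of_strong (t + 1) ht z hc hq
    have hlow (z : S × A × B) : optQ G H W z ≤ lowerQ (𝓔 (t + 1)) z := by
      by_cases hz : z = p.play t
      · rw [hz, lowerQ_run_play, ← hz]
        exact le_min (h2 z) (hup z)
      · rw [lowerQ_run_of_ne _ _ _ _ _ _ _ hz]
        exact h2 z
    refine ⟨h1', hlow, fun x => ?_⟩
    obtain ⟨ν', hn, hv⟩ := (consistent_run (G := G) (δ := δ) (T := T) (p := p)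
      hnash hD hH (t + 1)).exists_nash x
    rw [← hv, ← (hW x).2]
    exact (hW x).1.payoff_mono hn fun a b => hlow (x, a, b)

/-- Regret bound along a path on which the estimators are optimistic and the fluctuations are
controlled. -/
lemma regret_le (hnash : ∀ M, IsMatrixNash M (nash M).1 (nash M).2) (hD : 0 ≤ D) (hH : 1 ≤ H)
    (hL : 0 ≤ H * Real.log (2 * T / δ)) (hW : G.IsDiscountedValue (1 - 1 / H) W μ ν)
    (hspan : ∀ x y, W x ≤ W y + D) {J : ℝ} (hJ : ∀ x, J ≤ (1 - (1 - 1 / H)) * (W x + D))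
    (hnoise : ∀ t ≤ T, ∀ z, 1 ≤ count (𝓔 t) z →
      -bonus D H δ T (count (𝓔 t) z) ≤ visitNoise G nash D H δ T p W z (count (𝓔 t) z) t)
    {c₁ c₂ : ℝ} (hc₁ : 0 ≤ c₁) (h₁ : ∑ t ∈ Finset.range T, noise G p W t ≤ c₁) (ν' : ℕ → PMF B)
    (h₂ : ∑ t ∈ Finset.range T, (matrixPayoff ((𝓔 t).μ (p.s t)) (ν' t) ((𝓔 t).Qd (p.s t)) -
      lowerQ (𝓔 t) (p.play t)) ≤ c₂) :
    regret G J (p.hist T) ≤ T * D / H + (Fintype.card (S × A × B) + Fintype.card S + 1) * H +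
      2 * bonusSum (Fintype.card (S × A × B)) D H δ T + c₁ + c₂ + D := by
  have hH0 : 0 < H := by linarith
  obtain ⟨hγ0, hγ1⟩ := discount_mem hH
  have hopt := optimism hnash hD hH hL hW hnoise
  have he := fun t => consistent_run (G := G) (δ := δ) (T := T) (p := p) hnash hD hH t
  set N := ∑ t ∈ Finset.range T, noise G p W t with hN
  set X := ∑ t ∈ Finset.range T, ((𝓔 t).V (p.s t) - W (p.s t)) with hX
  set X' := ∑ t ∈ Finset.range T, ((𝓔 t).V (p.s (t + 1)) - W (p.s (t + 1))) with hX'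
  set R := ∑ t ∈ Finset.range T, (W (p.s t) - optQ G H W (p.play t)) with hR
  set sB := ∑ t ∈ Finset.range T, bonus D H δ T (count (𝓔 t) (p.play t) + 1) with hsB
  have hB : sB ≤ bonusSum (Fintype.card (S × A × B)) D H δ T := sum_bonus_le hD hL
  have hB0 : 0 ≤ sB := Finset.sum_nonneg fun t _ => bonus_nonneg hD _ _ _ _
  -- the shifted gap
  have hshift : X' ≤ X + (Fintype.card S + 1) * H := by
    refine sum_shift_le p.s (fun t x => (𝓔 t).V x - W x) T (fun t x => ?_) (fun x => ?_) fun x => ?_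
    · linarith [V_run_succ_le (G := G) (δ := δ) (T := T) (p := p) hnash hD hH t x]
    · linarith [(he 0).V_le x, hW.nonneg hγ0 hγ1 x]
    · linarith [(hopt T le_rfl).2 x]
  have hX'0 : 0 ≤ X' := Finset.sum_nonneg fun t ht =>
    sub_nonneg.2 ((hopt t (Finset.mem_range.1 ht).le).2 _)
  -- the gap of the action values
  have hgap : ∑ t ∈ Finset.range T, (upperQ (𝓔 t) (p.play t) - optQ G H W (p.play t)) ≤
      (1 + 1 / H) * ((1 - 1 / H) * X' + (1 - 1 / H) * N + sB) +
        Fintype.card (S × A × B) * H := by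
    rw [sum_upperQ_sub hH]
    simp only [target_sub_optQ]
    rw [Finset.sum_add_distrib, Finset.sum_add_distrib, ← Finset.mul_sum, ← Finset.mul_sum]
    have e1 : ∑ z, (H - optQ G H W z) ≤ Fintype.card (S × A × B) * H := by
      calc _ ≤ ∑ _z : S × A × B, H :=
            Finset.sum_le_sum fun z _ => by linarith [optQ_nonneg hH hW z]
        _ = _ := by simp only [Finset.sum_const, Finset.card_univ, nsmul_eq_mul]
    have e2 : 0 ≤ ∑ z, (H + count (𝓔 T) z) / H * (upperQ (𝓔 T) z - optQ G H W z) :=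
      Finset.sum_nonneg fun z _ => mul_nonneg (by positivity)
        (sub_nonneg.2 ((hopt T le_rfl).1 z))
    linarith
  -- The learner's equilibrium gives `V̄↓ ≤` mean payoff; `c₂` pays for replacing the mean by the
  -- realized `Q̄↓ ≤ Q̄`.
  have hchain : X + R ≤
      ∑ t ∈ Finset.range T, (upperQ (𝓔 t) (p.play t) - optQ G H W (p.play t)) + c₂ := by
    rw [hX, hR, ← Finset.sum_add_distrib]
    refine le_trans ?_ (add_le_add_right h₂ _)
    rw [← Finset.sum_add_distrib]
    refine Finset.sum_le_sum fun t _ => ?_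
    linarith [(he t).V_le_payoff (p.s t) (ν' t), (he t).lowerQ_le_upperQ (p.play t)]
  -- from action values to rewards
  have hreg : regret G J (p.hist T) ≤ T * D / H + (R - (1 - 1 / H) * N + D) := by
    rw [Path.regret_hist]
    -- After `J ≤ W/H + D/H`, this is an identity: the right side collapses to `D/H + W/H - r`.
    have e1 (t : ℕ) : J - G.r (p.s t) (p.a t) (p.b t) ≤ D / H +
        ((W (p.s t) - optQ G H W (p.play t)) - (1 - 1 / H) * noise G p W t +
          (1 - 1 / H) * (W (p.s (t + 1)) - W (p.s t))) := by
      have e2 := hJ (p.s t)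
      have e3 : (1 - (1 - 1 / H)) * D = D / H := by field_simp; ring
      simp only [optQ, StochasticGame.qValue, noise, Path.play]
      linarith
    refine (Finset.sum_le_sum fun t _ => e1 t).trans ?_
    rw [Finset.sum_add_distrib, Finset.sum_add_distrib, Finset.sum_sub_distrib, ← Finset.mul_sum,
      ← Finset.mul_sum, Finset.sum_range_sub (fun t => W (p.s t))]
    have e4 : (1 - 1 / H) * (W (p.s T) - W (p.s 0)) ≤ D := by
      nlinarith [hspan (p.s T) (p.s 0)]
    simp only [Finset.sum_const, Finset.card_range, nsmul_eq_mul]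
    rw [mul_div_assoc]
    linarith
  set u := 1 / H with hu
  have hu0 : 0 ≤ u := by positivity
  have hu1 : u ≤ 1 := by linarith
  -- The gap `X'` returns with coefficient at most `1`, so `X` cancels between `hchain` and
  -- `hshift`.
  have e5 : (1 + u) * ((1 - u) * X') ≤ X' := by nlinarith [mul_nonneg (mul_nonneg hu0 hu0) hX'0]
  have e6 : (1 + u) * sB ≤ 2 * sB := by nlinarith
  -- The noise enters with coefficient `1 - u²` from learning and `-(1 - u)` from the rewards; only
  -- `u (1 - u)` survives.
  have e7 : u * (1 - u) * N ≤ c₁ := by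
    have : 0 ≤ u * (1 - u) := mul_nonneg hu0 hγ0
    have : u * (1 - u) ≤ 1 := by nlinarith
    nlinarith
  linarith

end DONQ

/-! ### Probability of the good event -/

namespace DONQ

variable {S A B : Type*} [Fintype S] [Fintype A] [Fintype B]
  [DecidableEq S] [DecidableEq A] [DecidableEq B] [Nonempty A] [Nonempty B]

section Increments

variable (G : StochasticGame S A B) (nash : (A → B → ℝ) → PMF A × PMF B) (D H δ : ℝ) (T : ℕ)

/-- Exponential martingale increment for the weighted transition noise of `f`. -/
noncomputable def noiseInc (f : S → ℝ) (w : List (S × A × B) → S → A → B → ℝ)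
    (l : List (S × A × B)) (s : S) (a : A) (b : B) (s' : S) : ℝ :=
  w l s a b * (f s' - (G.P s a b).mean f) - w l s a b ^ 2 * D ^ 2 / 8

/-- Weight of the next observation in the estimator of `z` after `n` visits, scaled by `c`. -/
noncomputable def estimateWeight (z : S × A × B) (n : ℕ) (c : ℝ) (l : List (S × A × B)) (s : S)
    (a : A) (b : B) : ℝ :=
  c * if (s, a, b) = z then visitWeight H n (count (estimate G nash D H δ T l s) z + 1) else 0

/-- Exponential martingale increment for the fluctuation of `Q̄↓` due to the random actions. -/
noncomputable def payoffInc (opp : List (S × A × B) → S → PMF B) (c : ℝ)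
    (l : List (S × A × B)) (s : S) (a : A) (b : B) (_ : S) : ℝ :=
  c * (matrixPayoff ((estimate G nash D H δ T l s).μ s) (opp l s)
      ((estimate G nash D H δ T l s).Qd s) - (estimate G nash D H δ T l s).Qd s a b) -
    4 * c ^ 2 * ((estimate G nash D H δ T l s).Qd s a b ^ 2 -
      matrixPayoff ((estimate G nash D H δ T l s).μ s) (opp l s)
        ((estimate G nash D H δ T l s).Qd s) ^ 2)

variable {G nash D H δ T}

lemma consistent_estimate (hnash : ∀ M, IsMatrixNash M (nash M).1 (nash M).2) (hD : 0 ≤ D)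
    (hH : 1 ≤ H) (l : List (S × A × B)) (s : S) :
    Consistent H (estimate G nash D H δ T l s) := by
  obtain ⟨p, hp, hs⟩ := Path.exists_hist_eq l s
  have h := consistent_run (G := G) (δ := δ) (T := T) (p := p) hnash hD hH l.length
  rwa [run, hp, hs] at h

lemma stepMean_exp_payoffInc_le (hnash : ∀ M, IsMatrixNash M (nash M).1 (nash M).2) (hD : 0 ≤ D)
    (hH : 1 ≤ H) (opp : List (S × A × B) → S → PMF B) {c : ℝ} (hc : 0 ≤ c) (hcH : c * H ≤ 1 / 20)
    (l : List (S × A × B)) (s : S) :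
    stepMean G nash D H δ T opp l s
      (fun a b s' => Real.exp (payoffInc G nash D H δ T opp c l s a b s')) ≤ 1 := by
  have he := consistent_estimate (G := G) (δ := δ) (T := T) hnash hD hH l s
  simp only [stepMean, payoffInc, PMF.mean_const]
  exact mean_exp_matrixPayoff_sub_le _ _ _ (fun a b => he.lowerQ_nonneg (s, a, b))
    (fun a b => he.lowerQ_le (s, a, b)) hc hcH

end Increments

section PathEvents

variable {G : StochasticGame S A B} {nash : (A → B → ℝ) → PMF A × PMF B} {D H δ : ℝ} {T : ℕ}
  {p : Path S A B}

local notation "𝓔" => run G nash D H δ T p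

/-- The parameter of the exponential martingale for the estimators after `n` visits. -/
noncomputable def tilt (D H δ : ℝ) (T n : ℕ) : ℝ := 2 * n * bonus D H δ T n / (D ^ 2 * H)

/-- Chernoff with range `D` and squared weights summing to at most `2H/n`: `tilt` maximizes `c β -
c² D² H / (4n)`, with maximum `n β² / (D² H) = 4 log (2T/δ)`. The function `-W` gives the lower
tail. -/
lemma bonus_le_visitNoise (hD : 0 < D) (hH : 1 ≤ H) (hL : 0 < Real.log (2 * T / δ)) (W : S → ℝ)
    (z : S × A × B) {n : ℕ} (hn : 1 ≤ n)
    (h : pathSum (noiseInc G D (fun x => -W x) (estimateWeight G nash D H δ T z n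
      (tilt D H δ T n))) (p.hist T) (p.s T) < 4 * Real.log (2 * T / δ)) :
    -bonus D H δ T n ≤ visitNoise G nash D H δ T p W z n T := by
  have hn0 : (0 : ℝ) < n := by exact_mod_cast hn
  have hH0 : 0 < H := by linarith
  have hbsq : bonus D H δ T n ^ 2 = 4 * D ^ 2 * (H * Real.log (2 * T / δ) / n) := by
    rw [bonus, mul_pow, Real.sq_sqrt (by positivity)]
    ring
  have hb0 : 0 < bonus D H δ T n := by
    rw [bonus]
    have : 0 < Real.sqrt (H * Real.log (2 * T / δ) / n) := Real.sqrt_pos.2 (by positivity)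
    positivity
  set c := tilt D H δ T n with hc
  have hc0 : 0 < c := by rw [hc, tilt]; positivity
  have hcb : c * bonus D H δ T n - c ^ 2 * D ^ 2 / 8 * (2 * H / n) = 4 * Real.log (2 * T / δ) := by
    have e : c * bonus D H δ T n - c ^ 2 * D ^ 2 / 8 * (2 * H / n) =
        n * bonus D H δ T n ^ 2 / (D ^ 2 * H) := by
      rw [hc, tilt]
      field_simp
      ring
    rw [e, hbsq]
    field_simp
  have hsum : pathSum (noiseInc G D (fun x => -W x) (estimateWeight G nash D H δ T z n c))
      (p.hist T) (p.s T) = -(c * visitNoise G nash D H δ T p W z n T) - c ^ 2 * D ^ 2 / 8 *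
      ∑ u ∈ Finset.range T,
        (if p.play u = z then visitWeight H n (count (𝓔 u) z + 1) else 0) ^ 2 := by
    rw [Path.pathSum_hist, visitNoise, Finset.mul_sum, Finset.mul_sum, ← Finset.sum_neg_distrib,
      ← Finset.sum_sub_distrib]
    refine Finset.sum_congr rfl fun u _ => ?_
    have hmean : (G.P (p.s u) (p.a u) (p.b u)).mean (fun x => -W x) =
        -(G.P (p.s u) (p.a u) (p.b u)).mean W := by
      have := PMF.mean_const_mul (G.P (p.s u) (p.a u) (p.b u)) (-1) W
      simpa using this
    by_cases hz : p.play u = z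
    · have hz' : (p.s u, p.a u, p.b u) = z := hz
      simp only [noiseInc, estimateWeight, noise, hmean, if_pos hz, if_pos hz', run]
      ring
    · have hz' : (p.s u, p.a u, p.b u) ≠ z := hz
      simp only [noiseInc, estimateWeight, if_neg hz, if_neg hz']
      ring
  have h2 := mul_le_mul_of_nonneg_left
    (sum_visitWeight_count_sq_le (G := G) (nash := nash) (D := D) (δ := δ) (T := T) (p := p)
      hH z hn T) (by positivity : 0 ≤ c ^ 2 * D ^ 2 / 8)
  rw [hsum, ← hcb] at h
  have h3 : c * -bonus D H δ T n ≤ c * visitNoise G nash D H δ T p W z n T := by linarith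
  exact le_of_mul_le_mul_left h3 hc0

lemma sum_noise_le (W : S → ℝ) {x c : ℝ} (hc : 0 < c)
    (h : pathSum (noiseInc G D W (fun _ _ _ _ => c)) (p.hist T) (p.s T) < x) :
    ∑ t ∈ Finset.range T, noise G p W t ≤ x / c + c * T * D ^ 2 / 8 := by
  rw [Path.pathSum_hist] at h
  simp only [noiseInc, Finset.sum_sub_distrib, ← Finset.mul_sum, Finset.sum_const,
    Finset.card_range, nsmul_eq_mul] at h
  rw [← sub_le_iff_le_add, le_div_iff₀ hc]
  simp only [noise, Finset.sum_sub_distrib]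
  linarith

lemma sum_payoff_sub_le (hnash : ∀ M, IsMatrixNash M (nash M).1 (nash M).2) (hD : 0 ≤ D)
    (hH : 1 ≤ H) (hL : 0 ≤ H * Real.log (2 * T / δ)) (opp : List (S × A × B) → S → PMF B)
    {x c : ℝ} (hc : 0 < c)
    (h : pathSum (payoffInc G nash D H δ T opp c) (p.hist T) (p.s T) < x) :
    ∑ t ∈ Finset.range T, (matrixPayoff ((𝓔 t).μ (p.s t)) (opp (p.hist t) (p.s t))
      ((𝓔 t).Qd (p.s t)) - lowerQ (𝓔 t) (p.play t)) ≤
      x / c + 4 * c * squareSum (Fintype.card (S × A × B)) (Fintype.card S) D H δ T := by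
  have he := fun t => consistent_run (G := G) (δ := δ) (T := T) (p := p) hnash hD hH t
  rw [Path.pathSum_hist] at h
  simp only [payoffInc] at h
  rw [Finset.sum_sub_distrib, ← Finset.mul_sum, ← Finset.mul_sum] at h
  have h1 : ∑ t ∈ Finset.range T, (lowerQ (𝓔 t) (p.play t) ^ 2 -
      matrixPayoff ((𝓔 t).μ (p.s t)) (opp (p.hist t) (p.s t)) ((𝓔 t).Qd (p.s t)) ^ 2) ≤
      squareSum (Fintype.card (S × A × B)) (Fintype.card S) D H δ T := by
    refine le_trans (Finset.sum_le_sum fun t _ => ?_)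
      (sum_lowerQ_sq_sub_le (G := G) (δ := δ) (T := T) (p := p) hnash hD hH hL)
    have := pow_le_pow_left₀ ((he t).V_nonneg (p.s t))
      ((he t).V_le_payoff (p.s t) (opp (p.hist t) (p.s t))) 2
    linarith
  have h2 := mul_le_mul_of_nonneg_left h1 (by positivity : 0 ≤ 4 * c ^ 2)
  rw [← sub_le_iff_le_add, le_div_iff₀ hc]
  simp only [lowerQ, Path.play, run] at h2 ⊢
  nlinarith

end PathEvents

/-- The lower order terms of the regret bound. -/
noncomputable def errorTerm (k j : ℕ) (D H δ : ℝ) (T : ℕ) : ℝ :=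
  (k + j + 1) * H + 2 * bonusSum k D H δ T +
    Real.sqrt T * (Real.log (2 / δ) + D ^ 2 / 8) +
    (Real.log (2 / δ) / (T : ℝ) ^ (-(5 / 8) : ℝ) +
      4 * (T : ℝ) ^ (-(5 / 8) : ℝ) * squareSum k j D H δ T) + D

/-- High probability regret bound at a fixed horizon. -/
theorem regret_le_with_high_probability {G : StochasticGame S A B}
    {nash : (A → B → ℝ) → PMF A × PMF B} {D H δ : ℝ} {T : ℕ}
    (hnash : ∀ M, IsMatrixNash M (nash M).1 (nash M).2) (hD : 0 < D) (hH : 1 ≤ H)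
    (hδ : δ ∈ Set.Ioo (0 : ℝ) 1) (hT : 1 ≤ T) (hTk : Fintype.card (S × A × B) ≤ T)
    (hTH : (T : ℝ) ^ (-(5 / 8) : ℝ) * H ≤ 1 / 20) {W : S → ℝ} {μ : S → PMF A} {ν : S → PMF B}
    (hW : G.IsDiscountedValue (1 - 1 / H) W μ ν) (hspan : ∀ x y, W x ≤ W y + D) {J : ℝ}
    (hJ : ∀ x, J ≤ (1 - (1 - 1 / H)) * (W x + D)) (opp : List (S × A × B) → S → PMF B) (s₁ : S) :
    ENNReal.ofReal (1 - 3 * δ) ≤ (historyLaw G nash D H δ T opp s₁ T).toOuterMeasure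
      {h | regret G J h.1 ≤
        T * D / H + errorTerm (Fintype.card (S × A × B)) (Fintype.card S) D H δ T} := by
  obtain ⟨hδ0, hδ1⟩ := hδ
  have hT0 : (1 : ℝ) ≤ T := by exact_mod_cast hT
  have hx0 : 0 < Real.log (2 / δ) := Real.log_pos (by rw [lt_div_iff₀ hδ0]; linarith)
  have hL : 0 < Real.log (2 * T / δ) := Real.log_pos (by rw [lt_div_iff₀ hδ0]; linarith)
  have hHL : 0 ≤ H * Real.log (2 * T / δ) := by positivity
  set c₀ : ℝ := (T : ℝ) ^ (-(5 / 8) : ℝ) with hc₀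
  have hc₀0 : 0 < c₀ := by positivity
  set c₁ : ℝ := 1 / Real.sqrt T with hc₁
  have hc₁0 : 0 < c₁ := by positivity
  set law := historyLaw G nash D H δ T opp s₁ T with hlaw
  set bad₁ : (S × A × B) → ℕ → Set (List (S × A × B) × S) := fun z n =>
    {h | 4 * Real.log (2 * T / δ) ≤ pathSum (noiseInc G D (fun x => -W x)
      (estimateWeight G nash D H δ T z n (tilt D H δ T n))) h.1 h.2} with hbad₁
  set bad₂ : Set (List (S × A × B) × S) :=
    {h | Real.log (2 / δ) ≤ pathSum (noiseInc G D W (fun _ _ _ _ => c₁)) h.1 h.2} with hbad₂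
  set bad₃ : Set (List (S × A × B) × S) :=
    {h | Real.log (2 / δ) ≤ pathSum (payoffInc G nash D H δ T opp c₀) h.1 h.2} with hbad₃
  set good : Set (List (S × A × B) × S) := {h | regret G J h.1 ≤
    T * D / H + errorTerm (Fintype.card (S × A × B)) (Fintype.card S) D H δ T} with hgood
  set bad : Set (List (S × A × B) × S) :=
    (⋃ q ∈ (Finset.univ : Finset (S × A × B)) ×ˢ Finset.Icc 1 T, bad₁ q.1 q.2) ∪ bad₂ ∪ bad₃
    with hbad
  have hcover : law.support ⊆ good ∪ bad := by
    rintro ⟨l, x⟩ hl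
    have hlen := length_of_mem_support G nash D H δ T opp s₁ T _ hl
    simp only at hlen
    -- Histories in the support have length `T`, so the path estimates at time `T` apply.
    obtain ⟨p, hp, hs⟩ := Path.exists_hist_eq l x
    rw [hlen] at hp hs
    by_cases hb : (l, x) ∈ bad
    · exact Or.inr hb
    left
    simp only [hbad, Set.mem_union, Set.mem_iUnion, not_or, not_exists] at hb
    obtain ⟨⟨hb₁, hb₂⟩, hb₃⟩ := hb
    simp only [hbad₂, Set.mem_ofPred_eq, not_le, ← hp, ← hs] at hb₂
    simp only [hbad₃, Set.mem_ofPred_eq, not_le, ← hp, ← hs] at hb₃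
    have hnoise : ∀ t ≤ T, ∀ z, 1 ≤ count (run G nash D H δ T p t) z →
        -bonus D H δ T (count (run G nash D H δ T p t) z) ≤
          visitNoise G nash D H δ T p W z (count (run G nash D H δ T p t) z) t := by
      intro t ht z hz
      rw [← visitNoise_eq_of_le W z ht]
      refine bonus_le_visitNoise hD hH hL W z hz ?_
      have hmem : (z, count (run G nash D H δ T p t) z) ∈
          (Finset.univ : Finset (S × A × B)) ×ˢ Finset.Icc 1 T := by
        simp only [Finset.mem_product, Finset.mem_univ, Finset.mem_Icc, true_and]
        exact ⟨hz, (count_run_le _ _ _ _ _ _ _ t z).trans ht⟩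
      have := hb₁ _ hmem
      simpa only [hbad₁, Set.mem_ofPred_eq, not_le, ← hp, ← hs] using this
    have h := regret_le (c₁ := Real.log (2 / δ) / c₁ + c₁ * T * D ^ 2 / 8) hnash hD.le hH hHL hW
      hspan hJ hnoise (by positivity) (sum_noise_le W hc₁0 hb₂) (fun t => opp (p.hist t) (p.s t))
      (sum_payoff_sub_le hnash hD.le hH hHL opp hc₀0 hb₃)
    rw [hp] at h
    refine le_trans h (le_of_eq ?_)
    have e1 : c₁ * T = Real.sqrt T := by
      rw [hc₁, one_div, inv_mul_eq_div, Real.div_sqrt]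
    have e2 : Real.log (2 / δ) / c₁ = Real.sqrt T * Real.log (2 / δ) := by
      rw [hc₁, div_div_eq_mul_div, div_one, mul_comm]
    rw [e1, e2, errorTerm]
    ring
  have hexp : Real.exp (-Real.log (2 / δ)) = δ / 2 := by
    rw [Real.exp_neg, Real.exp_log (by positivity), inv_div]
  have hP₁ (z : S × A × B) (n : ℕ) : law.toOuterMeasure (bad₁ z n) ≤
      ENNReal.ofReal (Real.exp (-(4 * Real.log (2 * T / δ)))) :=
    historyLaw_le_pathSum_le G nash D H δ T opp s₁ _ (fun l s =>
      stepMean_exp_transition_le G nash D H δ T opp (fun x => -W x)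
        (fun x y => by linarith [hspan y x])
        (estimateWeight G nash D H δ T z n (tilt D H δ T n)) l s) T _
  have hP₂ : law.toOuterMeasure bad₂ ≤ ENNReal.ofReal (δ / 2) := by
    rw [← hexp]
    exact historyLaw_le_pathSum_le G nash D H δ T opp s₁ _ (fun l s =>
      stepMean_exp_transition_le G nash D H δ T opp W hspan (fun _ _ _ _ => c₁) l s) T _
  have hP₃ : law.toOuterMeasure bad₃ ≤ ENNReal.ofReal (δ / 2) := by
    rw [← hexp]
    exact historyLaw_le_pathSum_le G nash D H δ T opp s₁ _ (fun l s =>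
      stepMean_exp_payoffInc_le hnash hD.le hH opp hc₀0.le hTH l s) T _
  have hP₁' : law.toOuterMeasure
      (⋃ q ∈ (Finset.univ : Finset (S × A × B)) ×ˢ Finset.Icc 1 T, bad₁ q.1 q.2) ≤
      ENNReal.ofReal δ := by
    refine (MeasureTheory.measure_biUnion_finset_le _ _).trans
      ((Finset.sum_le_sum fun q _ => hP₁ q.1 q.2).trans ?_)
    rw [Finset.sum_const, Finset.card_product, Finset.card_univ, Nat.card_Icc,
      Nat.add_sub_cancel, ← ENNReal.ofReal_nsmul, nsmul_eq_mul]
    refine ENNReal.ofReal_le_ofReal ?_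
    have e1 : Real.exp (-(4 * Real.log (2 * T / δ))) = (δ / (2 * T)) ^ 4 := by
      rw [show -(4 * Real.log (2 * T / δ)) = (4 : ℕ) * (-Real.log (2 * T / δ)) by push_cast; ring,
        Real.exp_nat_mul, Real.exp_neg, Real.exp_log (by positivity), inv_div]
    have hk : (Fintype.card (S × A × B) : ℝ) ≤ T := by exact_mod_cast hTk
    rw [e1]
    push_cast
    -- At most `T` triples and `T` visit numbers, against a tail of `(δ / 2T)⁴`.
    calc _ ≤ (T : ℝ) * T * (δ / (2 * T)) ^ 4 := by gcongr
      _ = δ * (δ ^ 3 / (16 * T ^ 2)) := by field_simp; ring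
      _ ≤ δ * 1 := by
        gcongr
        rw [div_le_one (by positivity)]
        nlinarith [pow_le_one₀ (n := 3) hδ0.le hδ1.le]
      _ = δ := mul_one δ
  have hPbad : law.toOuterMeasure bad ≤ ENNReal.ofReal (2 * δ) := by
    calc _ ≤ law.toOuterMeasure
          (⋃ q ∈ (Finset.univ : Finset (S × A × B)) ×ˢ Finset.Icc 1 T, bad₁ q.1 q.2) +
          law.toOuterMeasure bad₂ + law.toOuterMeasure bad₃ :=
          (MeasureTheory.measure_union_le _ _).trans
            (add_le_add_left (MeasureTheory.measure_union_le _ _) _)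
      _ ≤ ENNReal.ofReal δ + ENNReal.ofReal (δ / 2) + ENNReal.ofReal (δ / 2) := by gcongr
      _ = ENNReal.ofReal (2 * δ) := by
          rw [← ENNReal.ofReal_add hδ0.le (by positivity),
            ← ENNReal.ofReal_add (by positivity) (by positivity)]
          congr 1
          ring
  have hone : 1 ≤ law.toOuterMeasure good + ENNReal.ofReal (2 * δ) := by
    rw [← (law.toOuterMeasure_apply_eq_one_iff _).2 hcover]
    exact (MeasureTheory.measure_union_le _ _).trans (by gcongr)
  -- The bad events cost only `δ + δ/2 + δ/2`.
  calc ENNReal.ofReal (1 - 3 * δ) ≤ ENNReal.ofReal (1 - 2 * δ) :=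
        ENNReal.ofReal_le_ofReal (by linarith)
    _ = 1 - ENNReal.ofReal (2 * δ) := by
        rw [ENNReal.ofReal_sub _ (by positivity), ENNReal.ofReal_one]
    _ ≤ _ := tsub_le_iff_right.2 hone

end DONQ

/-! ### Orders of growth of the error terms -/

section Growth

/-- `f(T) = O(T^x)`. -/
def GrowthAtMost (x : ℝ) (f : ℕ → ℝ) : Prop := f =O[atTop] fun T : ℕ => (T : ℝ) ^ x

namespace GrowthAtMost

variable {x y : ℝ} {f g : ℕ → ℝ}

lemma rpow (x : ℝ) : GrowthAtMost x fun T => (T : ℝ) ^ x := isBigO_refl _ _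

lemma mono (hf : GrowthAtMost x f) (h : x ≤ y) : GrowthAtMost y f := by
  refine IsBigO.trans hf (IsBigO.of_bound 1 ?_)
  filter_upwards [eventually_ge_atTop 1] with T hT
  have hT : (1 : ℝ) ≤ T := by exact_mod_cast hT
  rw [one_mul, Real.norm_of_nonneg (by positivity), Real.norm_of_nonneg (by positivity)]
  exact Real.rpow_le_rpow_of_exponent_le hT h

lemma add (hf : GrowthAtMost x f) (hg : GrowthAtMost x g) : GrowthAtMost x fun T => f T + g T :=
  IsBigO.add hf hg

lemma mul (hf : GrowthAtMost x f) (hg : GrowthAtMost y g) :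
    GrowthAtMost (x + y) fun T => f T * g T := by
  refine (IsBigO.mul hf hg).trans (IsBigO.of_bound 1 ?_)
  filter_upwards [eventually_ge_atTop 1] with T hT
  have hT : (0 : ℝ) < T := by exact_mod_cast hT
  rw [← Real.rpow_add hT, one_mul]

lemma const_mul (hf : GrowthAtMost x f) (c : ℝ) : GrowthAtMost x fun T => c * f T :=
  hf.const_mul_left c

lemma const (c : ℝ) : GrowthAtMost 0 fun _ => c := by
  simpa [GrowthAtMost] using isBigO_const_const c (one_ne_zero (α := ℝ)) atTop

lemma sqrt (hf : GrowthAtMost x f) : GrowthAtMost (x / 2) fun T => Real.sqrt (f T) := by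
  obtain ⟨c, hc0, hc⟩ := IsBigO.exists_nonneg hf
  refine IsBigO.of_bound (Real.sqrt c) ?_
  filter_upwards [hc.bound] with T hT
  rw [Real.norm_of_nonneg (Real.sqrt_nonneg _), Real.norm_of_nonneg (by positivity)]
  rw [Real.norm_of_nonneg (by positivity : (0 : ℝ) ≤ (T : ℝ) ^ x)] at hT
  calc Real.sqrt (f T) ≤ Real.sqrt (c * (T : ℝ) ^ x) :=
        Real.sqrt_le_sqrt ((le_abs_self _).trans hT)
    _ = Real.sqrt c * (T : ℝ) ^ (x / 2) := by
        rw [Real.sqrt_mul hc0, Real.sqrt_eq_rpow ((T : ℝ) ^ x), ← Real.rpow_mul (by positivity)]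
        ring_nf

lemma isLittleO (hf : GrowthAtMost x f) (h : x < y) : f =o[atTop] fun T : ℕ => (T : ℝ) ^ y := by
  refine IsBigO.trans_isLittleO hf ?_
  refine isLittleO_of_tendsto' ?_ ?_
  · filter_upwards [eventually_ge_atTop 1] with T hT h0
    have hT : (0 : ℝ) < T := by exact_mod_cast hT
    exact absurd h0 (Real.rpow_pos_of_pos hT y).ne'
  · have h1 : Tendsto (fun T : ℕ => (T : ℝ) ^ (-(y - x))) atTop (nhds 0) :=
      (tendsto_rpow_neg_atTop (sub_pos.2 h)).comp tendsto_natCast_atTop_atTop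
    refine h1.congr' ?_
    filter_upwards [eventually_ge_atTop 1] with T hT
    have hT : (0 : ℝ) < T := by exact_mod_cast hT
    rw [neg_sub, Real.rpow_sub hT]

end GrowthAtMost

end Growth

namespace DONQ

variable {D δ : ℝ}

/-- Any exponent below `1/4` would keep the bonuses below `T^{3/4}`; `1/8` leads to `11/16`. -/
lemma growth_log (hδ : 0 < δ) : GrowthAtMost (1 / 8) fun T => Real.log (2 * T / δ) := by
  have h1 : GrowthAtMost (1 / 8) fun T => Real.log T :=
    ((isLittleO_log_rpow_atTop (by norm_num)).comp_tendsto tendsto_natCast_atTop_atTop).isBigO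
  refine IsBigO.congr' (((GrowthAtMost.const (Real.log (2 / δ))).mono (by norm_num)).add h1) ?_
    EventuallyEq.rfl
  filter_upwards [eventually_ge_atTop 1] with T hT
  have hT : (0 : ℝ) < T := by exact_mod_cast hT
  rw [← Real.log_mul (by positivity) (by positivity)]
  congr 1
  ring

lemma growth_highProbH : GrowthAtMost (1 / 4) (highProbH D δ) :=
  (GrowthAtMost.rpow (1 / 4)).const_mul _

lemma growth_sqrt_mul_log (hδ : 0 < δ) :
    GrowthAtMost (3 / 16) fun T => Real.sqrt (highProbH D δ T * Real.log (2 * T / δ)) :=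
  (growth_highProbH.mul (growth_log hδ)).sqrt.mono (by norm_num)

lemma growth_natCast : GrowthAtMost 1 fun T => (T : ℝ) := by
  simpa using GrowthAtMost.rpow 1

lemma growth_bonusSum (k : ℕ) (hδ : 0 < δ) :
    GrowthAtMost (11 / 16) fun T => bonusSum k D (highProbH D δ T) δ T :=
  ((((growth_sqrt_mul_log hδ).mul growth_natCast.sqrt).const_mul _).const_mul _).mono (by norm_num)

lemma growth_squareSum (k j : ℕ) (hδ : 0 < δ) :
    GrowthAtMost (5 / 4) fun T => squareSum k j D (highProbH D δ T) δ T := by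
  have hH := growth_highProbH (D := D) (δ := δ)
  have hB := growth_bonusSum (D := D) k hδ
  have hb : GrowthAtMost (3 / 16) fun T => bonus D (highProbH D δ T) δ T 1 := by
    simpa [bonus] using (growth_sqrt_mul_log (D := D) hδ).const_mul (2 * D)
  have h1 : GrowthAtMost (5 / 4) fun T => (k + j + 1) * highProbH D δ T ^ 2 := by
    simpa only [sq] using ((hH.mul hH).const_mul (k + j + 1)).mono (by norm_num)
  have h2 : GrowthAtMost (5 / 4) fun T => 4 * highProbH D δ T *
      (T + bonusSum k D (highProbH D δ T) δ T) :=
    ((hH.const_mul 4).mul (growth_natCast.add (hB.mono (by norm_num)))).mono (by norm_num)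
  have h3 : GrowthAtMost (5 / 4) fun T => 4 * (T + bonus D (highProbH D δ T) δ T 1 *
      bonusSum k D (highProbH D δ T) δ T) :=
    ((growth_natCast.add ((hb.mul hB).mono (by norm_num))).const_mul 4).mono (by norm_num)
  exact (h1.add h2).add h3

/-- The bonuses dominate. In the action fluctuations, `T^{-5/8}` balances `1/c` against `c T^{5/4}`,
both of order `T^{5/8}`. -/
lemma growth_errorTerm (k j : ℕ) (hδ : 0 < δ) :
    GrowthAtMost (11 / 16) fun T => errorTerm k j D (highProbH D δ T) δ T := by
  have h1 : GrowthAtMost (11 / 16) fun T => (k + j + 1) * highProbH D δ T :=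
    (growth_highProbH.const_mul _).mono (by norm_num)
  have h2 : GrowthAtMost (11 / 16) fun T => 2 * bonusSum k D (highProbH D δ T) δ T :=
    (growth_bonusSum k hδ).const_mul 2
  have h3 : GrowthAtMost (11 / 16) fun T => Real.sqrt T * (Real.log (2 / δ) + D ^ 2 / 8) :=
    (growth_natCast.sqrt.mul (GrowthAtMost.const _)).mono (by norm_num)
  have h4 : GrowthAtMost (11 / 16) fun T => Real.log (2 / δ) / (T : ℝ) ^ (-(5 / 8) : ℝ) := by
    refine IsBigO.congr_left (((GrowthAtMost.rpow (5 / 8)).const_mul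
      (Real.log (2 / δ))).mono (by norm_num)) fun T => ?_
    rw [Real.rpow_neg (by positivity), div_inv_eq_mul]
  have h5 : GrowthAtMost (11 / 16) fun T => 4 * (T : ℝ) ^ (-(5 / 8) : ℝ) *
      squareSum k j D (highProbH D δ T) δ T :=
    (((GrowthAtMost.rpow (-(5 / 8))).const_mul 4).mul (growth_squareSum k j hδ)).mono (by norm_num)
  exact (((h1.add h2).add h3).add (h4.add h5)).add ((GrowthAtMost.const D).mono (by norm_num))

lemma log_two_div_rpow_pos (hδ : δ ∈ Set.Ioo (0 : ℝ) 1) :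
    0 < Real.log (2 / δ) ^ (1 / 2 : ℝ) := by
  obtain ⟨h0, h1⟩ := hδ
  exact Real.rpow_pos_of_pos (Real.log_pos (by rw [lt_div_iff₀ h0]; linarith)) _

lemma tendsto_highProbH (hD : 0 < D) (hδ : δ ∈ Set.Ioo (0 : ℝ) 1) :
    Tendsto (highProbH D δ) atTop atTop := by
  have hl := log_two_div_rpow_pos hδ
  exact ((tendsto_rpow_atTop (by norm_num)).comp tendsto_natCast_atTop_atTop).const_mul_atTop
    (Real.sqrt_pos.2 (by positivity))

lemma mul_div_highProbH (hD : 0 < D) (hδ : δ ∈ Set.Ioo (0 : ℝ) 1) {T : ℕ} (hT : 1 ≤ T) :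
    T * D / highProbH D δ T =
      Real.sqrt (D * Real.log (2 / δ) ^ (1 / 2 : ℝ)) * (T : ℝ) ^ (3 / 4 : ℝ) := by
  have hl := log_two_div_rpow_pos hδ
  have hT0 : (0 : ℝ) < T := by exact_mod_cast hT
  rw [highProbH]
  set l := Real.log (2 / δ) ^ (1 / 2 : ℝ)
  have h1 : 0 < Real.sqrt (D / l) := Real.sqrt_pos.2 (by positivity)
  have h2 : 0 < (T : ℝ) ^ (1 / 4 : ℝ) := by positivity
  have h3 : Real.sqrt (D * l) * Real.sqrt (D / l) = D := by
    rw [← Real.sqrt_mul (by positivity), show D * l * (D / l) = D * D by field_simp,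
      Real.sqrt_mul_self hD.le]
  have h4 : (T : ℝ) ^ (3 / 4 : ℝ) * (T : ℝ) ^ (1 / 4 : ℝ) = T := by
    rw [← Real.rpow_add hT0]
    norm_num
  rw [div_eq_iff (by positivity)]
  calc (T : ℝ) * D = ((T : ℝ) ^ (3 / 4 : ℝ) * (T : ℝ) ^ (1 / 4 : ℝ)) *
        (Real.sqrt (D * l) * Real.sqrt (D / l)) := by rw [h3, h4]
    _ = _ := by ring

/-- Smallness of `c H`, required by the exponential inequality for the payoffs. -/
lemma eventually_rpow_mul_highProbH_le :
    ∀ᶠ T : ℕ in atTop, (T : ℝ) ^ (-(5 / 8) : ℝ) * highProbH D δ T ≤ 1 / 20 := by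
  have h := ((GrowthAtMost.rpow (-(5 / 8))).mul (growth_highProbH (D := D) (δ := δ))).isLittleO
    (y := 0) (by norm_num)
  filter_upwards [h.bound (by norm_num : (0 : ℝ) < 1 / 20)] with T hT
  simpa using (le_abs_self _).trans hT

end DONQ

/-! ### The regret bound -/

theorem mainTheorem2 {S A B : Type*} [Fintype S] [Fintype A] [Fintype B]
    [DecidableEq S] [DecidableEq A] [DecidableEq B] [Nonempty S] [Nonempty A] [Nonempty B]
    (D δ : ℝ) (hD : 0 < D) (hδ : δ ∈ Set.Ioo (0 : ℝ) 1) :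
    ∃ (ε : ℕ → ℝ) (T₀ : ℕ),
      ε =o[atTop] (fun T : ℕ => (T : ℝ) ^ (3 / 4 : ℝ)) ∧
      (∀ T ≥ T₀, 1 < highProbH D δ T) ∧
      ∀ G : StochasticGame S A B, G.diameter ≤ ENNReal.ofReal D →
        ∃ J : ℝ, G.IsAverageValue J ∧
          ∀ T ≥ T₀, ∀ nash : (A → B → ℝ) → PMF A × PMF B,
            (∀ M, IsMatrixNash M (nash M).1 (nash M).2) →
            ∀ (opp : List (S × A × B) → S → PMF B) (s₁ : S),
              ENNReal.ofReal (1 - 3 * δ) ≤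
                (DONQ.historyLaw G nash D (highProbH D δ T) δ T opp s₁ T).toOuterMeasure
                  {h | regret G J h.1 ≤
                    Real.sqrt (D * Real.log (2 / δ) ^ (1 / 2 : ℝ)) * (T : ℝ) ^ (3 / 4 : ℝ)
                      + ε T} := by
  -- The threshold and `ε` are fixed before the game: they involve only the cardinalities, `D` and
  -- `δ`.
  obtain ⟨T₀, hT₀⟩ := eventually_atTop.1
    (((DONQ.tendsto_highProbH hD hδ).eventually_gt_atTop 1).and
      ((DONQ.eventually_rpow_mul_highProbH_le (D := D) (δ := δ)).and
        ((eventually_ge_atTop 1).and (eventually_ge_atTop (Fintype.card (S × A × B))))))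
  refine ⟨fun T => DONQ.errorTerm (Fintype.card (S × A × B)) (Fintype.card S) D
    (highProbH D δ T) δ T, T₀, (DONQ.growth_errorTerm _ _ hδ.1).isLittleO (by norm_num),
    fun T hT => (hT₀ T hT).1, fun G hG => ?_⟩
  obtain ⟨J, hJ, hJV⟩ := G.exists_isAverageValue hD.le hG
  refine ⟨J, hJ, fun T hT nash hnash opp s₁ => ?_⟩
  obtain ⟨hH, hTH, hT1, hTk⟩ := hT₀ T hT
  obtain ⟨hγ0, hγ1⟩ := DONQ.discount_mem hH.le
  obtain ⟨W, μ, ν, hW⟩ := G.exists_isDiscountedValue hγ0 hγ1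
  have h := DONQ.regret_le_with_high_probability hnash hD hH.le hδ hT1 hTk hTH hW
    (fun x y => hW.le_add_of_diameter_le hγ0 hγ1 hD.le hG y x)
    (hJV _ W μ ν hγ0 hγ1 hW) opp s₁
  rwa [DONQ.mul_div_highProbH hD hδ hT1] at h
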